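/- Let $\Phi$ be an irreducible reduced crystallographic root system (the root system of a complex simple Lie algebra), not of type $G_2$, with base $\Delta$, positive roots $\Phi^+$, highest root $\theta$, and a Weyl-invariant scalar product $(\cdot,\cdot)$ on $V=\langle\Phi\rangle_{\mathbb R}$. In $V\oplus\mathbb R\delta$ consider the real affine roots $\widehat\Phi=\{\alpha+n\delta : \alpha\in\Phi,\ n\in\mathbb Z\}$, the positive ones $\widehat\Phi^+=\Phi^+\cup\{\alpha+n\delta : \alpha\in\Phi,\ n>0\}$, the negative ones $\widehat\Phi^-=-\widehat\Phi^+$, and the base $\widehat\Delta=\Delta\cup\{\delta-\theta\}$. Extend $(\cdot,\cdot)$ to a symmetric bilinear form on $V\oplus\mathbb R\delta$ with kernel $\mathbb R\delta$, put $\langle\alpha,\beta\rangle=2(\alpha,\beta)/(\beta,\beta)$ for $\alpha,\beta\in\widehat\Phi$, and let $\widehat W\subset GL(V\oplus\mathbb R\delta)$ be the affine Weyl group, generated by the reflections $s_\alpha(x)=x-\frac{2(x,\alpha)}{(\alpha,\alpha)}\alpha$, $\alpha\in\widehat\Phi$. The reflections $s_\alpha$ with $\alpha\in\widehat\Delta$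 are called simple. For $w\in\widehat W$ let $\widehat\Phi(w)=\{\alpha\in\widehat\Phi^+ : w(\alpha)\in\widehat\Phi^-\}$ be its inversion set. Call $w$ fully commutative if no reduced expression of $w$ as a product of simple reflections contains a substring $s_\alpha s_\beta s_\alpha\cdots$ of length $m$, where $s_\alpha,s_\beta$ are non-commuting simple reflections and $s_\alpha s_\beta$ has finite order $m$. Then, for every $w\in\widehat W$, the element $w$ is fully commutative if and only if $\langle\alpha,\beta\rangle\ge 0$ for all $\alpha,\beta\in\widehat\Phi(w)$. -/

import Mathlib

namespace AffineRoots

variable {ι M N : Type*} [AddCommGroup M] [Module ℝ M] [AddCommGroup N] [Module ℝ N]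

/-- The affine (real) root `α + n δ`, where `α` is the root with index `a.1` and `n = a.2`, in the
space `M × ℝ`; here `M` is spanned by the finite root system and `δ = (0, 1)`. -/
noncomputable def root (P : RootPairing ι ℝ M N) (a : ι × ℤ) : M × ℝ :=
  (P.root a.1, (a.2 : ℝ))

/-- The linear form `x ↦ ⟨x, (α + n δ)^∨⟩ = ⟨x, α^∨⟩` on `M × ℝ`; it vanishes on `δ`. -/
noncomputable def coroot (P : RootPairing ι ℝ M N) (a : ι × ℤ) : Module.Dual ℝ (M × ℝ) :=
  (P.coroot' a.1).comp (LinearMap.fst ℝ M ℝ)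

lemma coroot_root_self (P : RootPairing ι ℝ M N) (a : ι × ℤ) : coroot P a (root P a) = 2 := by
  simp [coroot, root]

/-- The reflection `s_{α + n δ}` of `M × ℝ`. -/
noncomputable def reflection (P : RootPairing ι ℝ M N) (a : ι × ℤ) :
    (M × ℝ) ≃ₗ[ℝ] (M × ℝ) :=
  Module.reflection (coroot_root_self P a)

/-- The affine Weyl group: the group generated by the reflections in all affine roots. -/
def weylGroup (P : RootPairing ι ℝ M N) : Subgroup ((M × ℝ) ≃ₗ[ℝ] (M × ℝ)) :=
  Subgroup.closure (Set.range (reflection P))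

/-- The canonical Weyl-invariant scalar product on the span of the finite root system, extended to
`M × ℝ` so that `δ` spans the kernel. -/
noncomputable def form [Fintype ι] (P : RootPairing ι ℝ M N) : LinearMap.BilinForm ℝ (M × ℝ) :=
  P.RootForm.compl₁₂ (LinearMap.fst ℝ M ℝ) (LinearMap.fst ℝ M ℝ)

/-- `⟨x, y⟩ = 2 (x, y) / (y, y)`, for affine roots `x`, `y`. -/
noncomputable def pairing [Fintype ι] (P : RootPairing ι ℝ M N) (x y : M × ℝ) : ℝ :=
  2 * form P x y / form P y y

/-- On affine roots the pairing defined through the form is the pairing of the underlying finite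
roots. In particular it does not depend on the choice of the invariant form. -/
lemma pairing_root_root [Fintype ι] (P : RootPairing ι ℝ M N) [P.IsCrystallographic]
    (a c : ι × ℤ) : pairing P (root P a) (root P c) = P.pairing a.1 c.1 := by
  have h := (P.posRootForm ℤ).two_mul_apply_root_root a.1 c.1
  have h0 := (P.posRootForm ℤ).form_apply_root_ne_zero c.1
  exact (div_eq_iff h0).2 h

/-- The affine reflections are the orthogonal reflections of the extended form:
`s_c (x) = x - ⟨x, c⟩ c`. -/
lemma reflection_root [Fintype ι] (P : RootPairing ι ℝ M N) [P.IsCrystallographic]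
    (a c : ι × ℤ) :
    reflection P c (root P a) = root P a - pairing P (root P a) (root P c) • root P c := by
  rw [pairing_root_root, reflection, Module.reflection_apply]
  simp [coroot, root]

variable {P : RootPairing ι ℝ M N}

/-- The positive affine roots: `α` with `α` positive, and `α + n δ` with `n > 0`. -/
def posRoots (b : P.Base) : Set (M × ℝ) :=
  {x | ∃ a : ι × ℤ, x = root P a ∧ (0 < a.2 ∨ (a.2 = 0 ∧ b.IsPos a.1))}

/-- The negative affine roots. -/
def negRoots (b : P.Base) : Set (M × ℝ) :=
  {x | -x ∈ posRoots b}

/-- The set of inversions of `w`. -/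
def inversionSet (b : P.Base) (w : (M × ℝ) ≃ₗ[ℝ] (M × ℝ)) : Set (M × ℝ) :=
  {x | x ∈ posRoots b ∧ w x ∈ negRoots b}

/-- `i` is the index of the highest root `θ`: for every root `β`, the difference `θ - β` is a
sum of simple roots. -/
def IsHighest (b : P.Base) (i : ι) : Prop :=
  ∀ j : ι, P.root i - P.root j ∈ AddSubmonoid.closure (P.root '' (b.support : Set ι))

/-- The affine simple roots: the simple roots of the finite root system, together with
`δ - θ` where `θ` is the highest root. -/
def IsSimple (b : P.Base) (a : ι × ℤ) : Prop :=
  (a.1 ∈ b.support ∧ a.2 = 0) ∨ (∃ i, IsHighest b i ∧ P.root a.1 = -P.root i ∧ a.2 = 1)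

/-- The product of the simple reflections along a word in the affine simple roots. -/
noncomputable def wordProd (b : P.Base) (l : List {a : ι × ℤ // IsSimple b a}) :
    (M × ℝ) ≃ₗ[ℝ] (M × ℝ) :=
  (l.map fun a ↦ reflection P a.1).prod

/-- `l` is a reduced expression for `w`: its product is `w`, and it has minimal length among
all the words with this property. -/
def IsReducedExpression (b : P.Base) (w : (M × ℝ) ≃ₗ[ℝ] (M × ℝ))
    (l : List {a : ι × ℤ // IsSimple b a}) : Prop :=
  wordProd b l = w ∧ ∀ l', wordProd b l' = w → l.length ≤ l'.length

/-- `w` is fully commutative: no reduced expression for `w` contains a substring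
`s_α s_β s_α ⋯` of length `m(s_α, s_β)`, where `s_α`, `s_β` are non-commuting simple reflections.
Here `m(s_α, s_β)` is the order of `s_α s_β`; when this order is infinite (which `orderOf` encodes
as `0`) there is no such substring. As `α` and `β` range over all ordered pairs, it does not matter
that `alternatingWord α β m` is normalized by its last letter `β` instead of its first one. -/
def IsFullyCommutative (b : P.Base) (w : (M × ℝ) ≃ₗ[ℝ] (M × ℝ)) : Prop :=
  ∀ l, IsReducedExpression b w l → ∀ α β : {a : ι × ℤ // IsSimple b a},
    ¬ Commute (reflection P α.1) (reflection P β.1) →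
    orderOf (reflection P α.1 * reflection P β.1) ≠ 0 →
    ¬ CoxeterSystem.alternatingWord α β
        (orderOf (reflection P α.1 * reflection P β.1)) <:+: l

end AffineRoots

/-!
The theorem is proved for an abstract `ReflectionSystem`: real roots in a space with a positive
semidefinite form, whose Cartan integers are at most `2` in absolute value. The affine root system
is such a system (`affineSystem`): positivity is measured by the height for which all affine simple
roots have height one, and excluding `G₂` gives the bound on the Cartan integers. Its construction
needs the highest root of an irreducible root system (`exists_isHighest`). The simple reflections
generate the affine Weyl group (`exists_wordProd_eq_of_mem_weylGroup`), so `w` has reduced words.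

If a reduced word of `w` contains a braid in `α i` and `α j`, the two ways of writing the braid give
two reduced words. The inversions that belong to the last letter of the braid in these two words
are images of `α i` and `α j` under one isometry, hence at an obtuse angle
(`isFullyCommutative_of_form_nonneg`).

For the converse (`form_nonneg_of_isFullyCommutative`) let `w` be fully commutative. By induction on
the length, an obtuse pair of inversions must contain every simple root that is an inversion, so it
has the form `(α i, y)` and `i` is the only right descent of `w` (`IsMinimalObtuse`). The root
`s_i y = y + α i` stays an inversion of `w s_i`, so `w s_i` has a right descent `k`. Since all other
pairs of inversions are non-obtuse, the inner products of `α i`, `α k` and `y` are determined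
(`IsSecondLetter`), and `s_k` fixes `y + α i`. Hence there is a further descent `l` of `w s_i s_k`;
again all inner products are determined (`IsThirdLetter`), now with the help of the Cauchy–Schwarz
inequality, and `s_l` fixes `y + α i`. The same happens with a fourth letter `m`
(`IsFourthLetter`), which differs from `k` because `w` contains no braid `k l k`. For it the
Cauchy–Schwarz inequality is an equality: `α m` is, up to the radical of the form, an explicit
combination of `α i`, `α k`, `α l` and `y`. There is still a fifth letter `n`, and for it the
corresponding inversion is at an obtuse angle with `y`, a contradiction (`IsMinimalObtuse.false`).
-/

namespace AffineRoots

/-! ### Reflection systems -/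

/-- A crystallographic system of real roots in a real vector space with a positive semidefinite
form, together with simple roots `simple i` and simple reflections `refl i`. Positivity of roots is
measured by a linear form `ht`; the set of roots may be infinite. The Cartan integers of pairs of
roots are bounded by `2` in absolute value; the pairs `(2, 2)` and `(-2, -2)` belong to roots that
are equal or opposite modulo the radical of the form. -/
structure ReflectionSystem (I V : Type*) [AddCommGroup V] [Module ℝ V] where
  /-- The invariant form; it may have a radical. -/
  form : LinearMap.BilinForm ℝ V
  form_comm (x y : V) : form x y = form y x
  form_self_nonneg (x : V) : 0 ≤ form x x
  /-- The set of (real) roots. -/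
  roots : Set V
  /-- The simple roots. -/
  simple : I → V
  /-- The simple reflections. -/
  refl : I → V ≃ₗ[ℝ] V
  /-- The linear form whose sign decides which roots are positive. -/
  ht : V →ₗ[ℝ] ℝ
  form_self_pos {x : V} : x ∈ roots → 0 < form x x
  ht_ne_zero {x : V} : x ∈ roots → ht x ≠ 0
  simple_injective : Function.Injective simple
  simple_mem (i : I) : simple i ∈ roots
  ht_simple_pos (i : I) : 0 < ht (simple i)
  refl_eq (i : I) (x : V) :
    refl i x = x - (2 * form x (simple i) / form (simple i) (simple i)) • simple i
  refl_mem (i : I) {x : V} : x ∈ roots → refl i x ∈ roots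
  ht_refl_pos (i : I) {x : V} : x ∈ roots → 0 < ht x → x ≠ simple i → 0 < ht (refl i x)
  mem_closure {x : V} : x ∈ roots → 0 < ht x → x ∈ AddSubmonoid.closure (Set.range simple)
  form_simple_le {i j : I} : i ≠ j → form (simple i) (simple j) ≤ 0
  pairing_mem {x y : V} : x ∈ roots → y ∈ roots →
    (2 * form x y / form y y, 2 * form y x / form x x) ∈
      ({(0, 0), (1, 1), (1, 2), (2, 1), (2, 2),
        (-1, -1), (-1, -2), (-2, -1), (-2, -2)} : Set (ℝ × ℝ))
  /-- A simple root is the lowest positive root in its class modulo the radical of the form. -/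
  ht_simple_le (i : I) {x : V} : x ∈ roots → 0 < ht x →
    form (x - simple i) (x - simple i) = 0 → ht (simple i) ≤ ht x

namespace ReflectionSystem

variable {I V : Type*} [AddCommGroup V] [Module ℝ V] (S : ReflectionSystem I V)

/-- The Cartan number `⟨x, α i⟩`. -/
noncomputable def pairing (x : V) (i : I) : ℝ :=
  2 * S.form x (S.simple i) / S.form (S.simple i) (S.simple i)

lemma form_simple_pos (i : I) : 0 < S.form (S.simple i) (S.simple i) :=
  S.form_self_pos (S.simple_mem i)

lemma refl_apply (i : I) (x : V) : S.refl i x = x - S.pairing x i • S.simple i :=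
  S.refl_eq i x

lemma pairing_mul (x : V) (i : I) :
    S.pairing x i * S.form (S.simple i) (S.simple i) = 2 * S.form x (S.simple i) :=
  div_mul_cancel₀ _ (S.form_simple_pos i).ne'

lemma pairing_sub (x y : V) (i : I) : S.pairing (x - y) i = S.pairing x i - S.pairing y i := by
  simp only [pairing, map_sub, LinearMap.sub_apply]; ring

lemma pairing_smul (c : ℝ) (x : V) (i : I) : S.pairing (c • x) i = c * S.pairing x i := by
  simp only [pairing, map_smul, LinearMap.smul_apply, smul_eq_mul]; ring

lemma pairing_self (i : I) : S.pairing (S.simple i) i = 2 := by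
  have := (S.form_simple_pos i).ne'
  simp only [pairing]; field_simp

lemma refl_simple (i : I) : S.refl i (S.simple i) = - S.simple i := by
  rw [refl_apply, pairing_self]; module

lemma refl_of_form_eq_zero {i : I} {x : V} (h : S.form x (S.simple i) = 0) : S.refl i x = x := by
  simp [refl_apply, pairing, h]

lemma refl_refl (i : I) (x : V) : S.refl i (S.refl i x) = x := by
  rw [refl_apply, refl_apply, pairing_sub, pairing_smul, pairing_self]; module

lemma refl_mul_self (i : I) : S.refl i * S.refl i = 1 := by
  ext x; simp [refl_refl]

lemma refl_mul_cancel (i : I) (w : V ≃ₗ[ℝ] V) : w * S.refl i * S.refl i = w := by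
  rw [mul_assoc, refl_mul_self, mul_one]

lemma refl_inv (i : I) : (S.refl i)⁻¹ = S.refl i :=
  inv_eq_of_mul_eq_one_left (S.refl_mul_self i)

lemma form_refl_refl (i : I) (x y : V) : S.form (S.refl i x) (S.refl i y) = S.form x y := by
  have h1 := S.pairing_mul x i
  have h2 := S.pairing_mul y i
  have h3 := S.form_comm (S.simple i) y
  simp only [refl_apply, map_sub, map_smul, LinearMap.sub_apply, LinearMap.smul_apply, smul_eq_mul]
  rw [h3]
  linear_combination (S.pairing y i / 2) * h1 + (S.pairing x i / 2) * h2

lemma form_refl_left (i : I) (x y : V) : S.form (S.refl i x) y = S.form x (S.refl i y) := by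
  rw [← S.form_refl_refl i, refl_refl]

/-- The Cauchy–Schwarz inequality. -/
lemma form_sq_le (x y : V) : S.form x y ^ 2 ≤ S.form x x * S.form y y :=
  S.form.apply_sq_le_of_symm S.form_self_nonneg ⟨fun x y ↦ by simp [S.form_comm x y]⟩ x y

lemma form_eq_zero_of_self {x : V} (h : S.form x x = 0) (y : V) : S.form x y = 0 := by
  have := S.form_sq_le x y
  rw [h, zero_mul] at this
  exact pow_eq_zero_iff (two_ne_zero) |>.1 (le_antisymm this (sq_nonneg _))

/-! ### Words, exchange and descents -/

/-- The product of the simple reflections along a word. -/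
noncomputable def wordProd (l : List I) : V ≃ₗ[ℝ] V := (l.map S.refl).prod

@[simp] lemma wordProd_nil : S.wordProd [] = 1 := rfl

@[simp] lemma wordProd_cons (i : I) (l : List I) :
    S.wordProd (i :: l) = S.refl i * S.wordProd l := by simp [wordProd]

@[simp] lemma wordProd_append (l l' : List I) :
    S.wordProd (l ++ l') = S.wordProd l * S.wordProd l' := by simp [wordProd]

lemma wordProd_reverse (l : List I) : S.wordProd l.reverse = (S.wordProd l)⁻¹ := by
  induction l with
  | nil => simp
  | cons i l ih => simp [ih, refl_inv]

lemma form_wordProd (l : List I) (x y : V) :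
    S.form (S.wordProd l x) (S.wordProd l y) = S.form x y := by
  induction l with
  | nil => simp
  | cons i l ih => simp [form_refl_refl, ih]

lemma wordProd_mem (l : List I) {x : V} (hx : x ∈ S.roots) : S.wordProd l x ∈ S.roots := by
  induction l with
  | nil => simpa
  | cons i l ih => simpa using S.refl_mem i ih

lemma wordProd_of_form_eq_zero (l : List I) {x : V} (hx : ∀ y, S.form x y = 0) :
    S.wordProd l x = x := by
  induction l with
  | nil => simp
  | cons i l ih => simp [ih, S.refl_of_form_eq_zero (hx _)]

/-- The only positive root sent to a negative one by a simple reflection is the simple root. -/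
lemma eq_simple_of_ht_refl_neg {i : I} {x : V} (hx : x ∈ S.roots) (hp : 0 < S.ht x)
    (hn : S.ht (S.refl i x) < 0) : x = S.simple i := by
  by_contra h
  exact absurd (S.ht_refl_pos i hx hp h) hn.not_gt

lemma ht_pos_or_neg {x : V} (hx : x ∈ S.roots) : 0 < S.ht x ∨ S.ht x < 0 :=
  (S.ht_ne_zero hx).lt_or_gt.symm

lemma ht_refl_pos_of_form_nonpos {i : I} {x : V} (hp : 0 < S.ht x)
    (h : S.form x (S.simple i) ≤ 0) : 0 < S.ht (S.refl i x) := by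
  have h1 : S.pairing x i ≤ 0 :=
    div_nonpos_of_nonpos_of_nonneg (by linarith) (S.form_simple_pos i).le
  have h2 := S.ht_simple_pos i
  rw [refl_apply, map_sub, map_smul, smul_eq_mul]
  nlinarith

/-- Conjugating a simple reflection by an element that sends its root to a simple root. -/
lemma refl_mul_wordProd {l : List I} {i j : I} (h : S.wordProd l (S.simple i) = S.simple j) :
    S.refl j * S.wordProd l = S.wordProd l * S.refl i := by
  ext x
  have : S.pairing (S.wordProd l x) j = S.pairing x i := by
    simp only [pairing, ← h, form_wordProd]
  simp [refl_apply, this, h]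

/-- The exchange condition. -/
lemma exists_wordProd_eq_mul_refl (l : List I) {i : I} (h : S.ht (S.wordProd l (S.simple i)) < 0) :
    ∃ l', S.wordProd l = S.wordProd l' * S.refl i ∧ l'.length + 1 = l.length := by
  induction l with
  | nil => exact absurd (S.ht_simple_pos i) (by simpa using h.le)
  | cons j t ih =>
    rcases S.ht_pos_or_neg (S.wordProd_mem t (S.simple_mem i)) with hp | hn
    · have := S.eq_simple_of_ht_refl_neg (i := j) (S.wordProd_mem t (S.simple_mem i)) hp
        (by simpa using h)
      exact ⟨t, by rw [wordProd_cons, S.refl_mul_wordProd this], rfl⟩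
    · obtain ⟨l', h1, h2⟩ := ih hn
      exact ⟨j :: l', by simp [h1, mul_assoc], by simp [h2]⟩

/-- `l` is a word of minimal length with product `w`. -/
def IsReduced (w : V ≃ₗ[ℝ] V) (l : List I) : Prop :=
  S.wordProd l = w ∧ ∀ l', S.wordProd l' = w → l.length ≤ l'.length

lemma exists_isReduced (l : List I) : ∃ l', S.IsReduced (S.wordProd l) l' := by
  obtain ⟨l', h1, h2⟩ := exists_minimalFor_of_wellFoundedLT
    (fun l' ↦ S.wordProd l' = S.wordProd l) List.length ⟨l, rfl⟩
  exact ⟨l', h1, fun l'' h ↦ (le_total _ _).elim id (h2 h)⟩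

variable {S}

lemma IsReduced.append_left {w : V ≃ₗ[ℝ] V} {l l' : List I} (h : S.IsReduced w (l ++ l')) :
    S.IsReduced (S.wordProd l) l :=
  ⟨rfl, fun m hm ↦ by simpa using h.2 (m ++ l') (by rw [← h.1]; simp [hm])⟩

lemma IsReduced.append_right {w : V ≃ₗ[ℝ] V} {l l' : List I} (h : S.IsReduced w (l ++ l')) :
    S.IsReduced (S.wordProd l') l' :=
  ⟨rfl, fun m hm ↦ by simpa using h.2 (l ++ m) (by rw [← h.1]; simp [hm])⟩

lemma IsReduced.ht_pos {w : V ≃ₗ[ℝ] V} {l : List I} {i : I} (h : S.IsReduced w (l ++ [i])) :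
    0 < S.ht (S.wordProd l (S.simple i)) := by
  refine (S.ht_pos_or_neg (S.wordProd_mem l (S.simple_mem i))).resolve_right fun hn ↦ ?_
  obtain ⟨l', h1, h2⟩ := S.exists_wordProd_eq_mul_refl l hn
  have := h.2 l' (by rw [← h.1]; simp [h1, refl_mul_cancel])
  simp at this; omega

lemma IsReduced.ht_inv_pos {w : V ≃ₗ[ℝ] V} {l : List I} {i : I} (h : S.IsReduced w (i :: l)) :
    0 < S.ht ((S.wordProd l)⁻¹ (S.simple i)) := by
  rw [← wordProd_reverse]
  refine (S.ht_pos_or_neg (S.wordProd_mem _ (S.simple_mem i))).resolve_right fun hn ↦ ?_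
  obtain ⟨l', h1, h2⟩ := S.exists_wordProd_eq_mul_refl _ hn
  have := h.2 l'.reverse (by
    rw [wordProd_reverse] at h1
    rw [← h.1, wordProd_cons, wordProd_reverse, inv_eq_iff_mul_eq_one,
      ← mul_assoc, ← h1, inv_mul_cancel])
  simp at this h2; omega

/-- Appending a right descent to a reduced word. -/
lemma IsReduced.append_singleton {l l₀ : List I} {i : I}
    (hn : S.ht (S.wordProd l₀ (S.simple i)) < 0)
    (h : S.IsReduced (S.wordProd l₀ * S.refl i) l) : S.IsReduced (S.wordProd l₀) (l ++ [i]) := by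
  refine ⟨by simp [h.1, refl_mul_cancel], fun m hm ↦ ?_⟩
  obtain ⟨l', h1, h2⟩ := S.exists_wordProd_eq_mul_refl m (i := i) (by rwa [hm])
  have := h.2 l' (by rw [← hm, h1, refl_mul_cancel])
  simp; omega

variable (S)

/-- The positive roots that `w` makes negative. -/
def inversions (w : V ≃ₗ[ℝ] V) : Set V := {x | x ∈ S.roots ∧ 0 < S.ht x ∧ S.ht (w x) < 0}

/-- An element with an inversion has a right descent. -/
lemma exists_descent {l : List I} {x : V} (hx : x ∈ S.roots) (hp : 0 < S.ht x)
    (hn : S.ht (S.wordProd l x) < 0) : ∃ i, S.ht (S.wordProd l (S.simple i)) < 0 := by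
  by_contra! h
  have : ∀ z ∈ AddSubmonoid.closure (Set.range S.simple), 0 ≤ S.ht (S.wordProd l z) := by
    intro z hz
    induction hz using AddSubmonoid.closure_induction with
    | mem z hz => obtain ⟨i, rfl⟩ := hz; exact h i
    | zero => simp
    | add a b _ _ ha hb => simpa using add_nonneg ha hb
  exact absurd hn (this x (S.mem_closure hx hp)).not_gt

/-- No reduced word of `w` contains an alternating word in two non-commuting simple reflections
whose length is the (finite) order of their product. -/
def IsFullyCommutative (w : V ≃ₗ[ℝ] V) : Prop :=
  ∀ l, S.IsReduced w l → ∀ i j : I, ¬ Commute (S.refl i) (S.refl j) →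
    orderOf (S.refl i * S.refl j) ≠ 0 →
    ¬ CoxeterSystem.alternatingWord i j (orderOf (S.refl i * S.refl j)) <:+: l

/-! ### Full commutativity from non-obtuse inversions -/

lemma commute_of_form_eq_zero {i j : I} (h : S.form (S.simple i) (S.simple j) = 0) :
    Commute (S.refl i) (S.refl j) := by
  have h' := h
  rw [form_comm] at h'
  ext x
  simp [refl_apply, pairing, h, h']
  abel

lemma not_commute_of_form_neg {i j : I} (h : S.form (S.simple i) (S.simple j) < 0) :
    ¬ Commute (S.refl i) (S.refl j) := by
  intro hc
  have h1 : S.refl i (S.refl j (S.simple j)) = S.refl j (S.refl i (S.simple j)) :=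
    LinearEquiv.congr_fun hc _
  have hji : S.form (S.simple j) (S.simple i) < 0 := by rwa [form_comm]
  have hp : S.pairing (S.simple j) i < 0 :=
    div_neg_of_neg_of_pos (by linarith) (S.form_simple_pos i)
  have hq : S.pairing (S.simple i) j < 0 :=
    div_neg_of_neg_of_pos (by linarith) (S.form_simple_pos j)
  have := congrArg S.ht h1
  simp only [refl_apply, map_sub, map_smul, smul_eq_mul, pairing_self] at this
  nlinarith [S.ht_simple_pos i, S.ht_simple_pos j, mul_pos_of_neg_of_neg hp hq,
    mul_pos (neg_pos.2 hp) (S.ht_simple_pos i),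
    mul_pos (mul_pos_of_neg_of_neg hp hq) (S.ht_simple_pos j)]

lemma alternatingWord_prod (i j : I) (m : ℕ) :
    S.wordProd (CoxeterSystem.alternatingWord i j m) =
      (if Even m then 1 else S.refl j) * (S.refl i * S.refl j) ^ (m / 2) := by
  induction m with
  | zero => simp [CoxeterSystem.alternatingWord]
  | succ m ih =>
    rw [CoxeterSystem.alternatingWord_succ', wordProd_cons, ih]
    by_cases hm : Even m
    · have h₁ : ¬ Even (m + 1) := by simp [hm, parity_simps]
      have h₂ : (m + 1) / 2 = m / 2 := Nat.succ_div_of_not_dvd <| by rwa [← even_iff_two_dvd]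
      simp [hm, h₁, h₂]
    · have h₁ : Even (m + 1) := by simp [hm, parity_simps]
      have h₂ : (m + 1) / 2 = m / 2 + 1 := Nat.succ_div_of_dvd h₁.two_dvd
      simp [hm, h₁, h₂, ← pow_succ', ← mul_assoc]

/-- The braid relation: it needs only the order of the product. -/
lemma alternatingWord_prod_comm (i j : I) :
    S.wordProd (CoxeterSystem.alternatingWord i j (orderOf (S.refl i * S.refl j))) =
      S.wordProd (CoxeterSystem.alternatingWord j i (orderOf (S.refl i * S.refl j))) := by
  have hinv : S.refl j * S.refl i = (S.refl i * S.refl j)⁻¹ := by simp [refl_inv]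
  have h := pow_orderOf_eq_one (S.refl i * S.refl j)
  set m := orderOf (S.refl i * S.refl j)
  rw [alternatingWord_prod, alternatingWord_prod, hinv]
  rcases Nat.even_or_odd' m with ⟨c, hc | hc⟩
  · have : m / 2 = c := by omega
    rw [if_pos (by simp [hc]), if_pos (by simp [hc]), this, inv_pow, one_mul, one_mul,
      eq_inv_iff_mul_eq_one, ← pow_add, ← two_mul, ← hc, h]
  · have : m / 2 = c := by omega
    rw [if_neg (by simp [hc]), if_neg (by simp [hc]), this, inv_pow, eq_mul_inv_iff_mul_eq,
      mul_assoc, ← pow_add, ← two_mul, ← mul_right_inj (S.refl i), ← mul_assoc, ← pow_succ',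
      ← hc, h, refl_mul_self]

variable {S}

/-- Every letter of a reduced word contributes an inversion. -/
lemma IsReduced.inv_mem_inversions {w : V ≃ₗ[ℝ] V} {l v : List I} {i : I}
    (h : S.IsReduced w (l ++ i :: v)) : (S.wordProd v)⁻¹ (S.simple i) ∈ S.inversions w := by
  refine ⟨by rw [← wordProd_reverse]; exact S.wordProd_mem _ (S.simple_mem i),
    h.append_right.ht_inv_pos, ?_⟩
  have h' : S.IsReduced w ((l ++ [i]) ++ v) := by simpa using h
  have := h'.append_left.ht_pos
  rw [← h.1]
  simpa [refl_simple, LinearEquiv.apply_symm_apply] using this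

/-- Pairwise non-obtuse inversions force full commutativity: the two ends of a braid in a reduced
word are the images of the two simple roots involved. -/
theorem isFullyCommutative_of_form_nonneg {w : V ≃ₗ[ℝ] V}
    (h : ∀ x ∈ S.inversions w, ∀ y ∈ S.inversions w, 0 ≤ S.form x y) :
    S.IsFullyCommutative w := by
  rintro l hl i j hc hm ⟨u, v, rfl⟩
  obtain ⟨m, hm'⟩ := Nat.exists_eq_succ_of_ne_zero hm
  -- Both alternating words have the same product, so both can be placed between `u` and `v`.
  have hcomm := S.alternatingWord_prod_comm i j
  rw [hm'] at hl hcomm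
  have h1 : S.IsReduced w (u ++ CoxeterSystem.alternatingWord j i m.succ ++ v) :=
    ⟨by rw [← hl.1]; simp [hcomm], fun l' hl' ↦ by simpa using hl.2 l' hl'⟩
  simp only [Nat.succ_eq_add_one, CoxeterSystem.alternatingWord_succ, List.concat_eq_append,
    List.append_assoc, List.singleton_append] at hl h1
  rw [← List.append_assoc] at hl h1
  have := h _ hl.inv_mem_inversions _ h1.inv_mem_inversions
  rw [← wordProd_reverse, form_wordProd] at this
  have hji : j ≠ i := by rintro rfl; exact hc rfl
  have h0 := le_antisymm (S.form_simple_le hji) this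
  exact hc (S.commute_of_form_eq_zero h0).symm

/-! ### Rank two -/

/-- The possible Cartan integers of an obtuse pair of roots. -/
lemma form_cases_of_neg {x y : V} (hx : x ∈ S.roots) (hy : y ∈ S.roots) (h : S.form x y < 0) :
    (2 * S.form x y = -S.form x x ∧ 2 * S.form x y = -S.form y y) ∨
    (2 * S.form x y = -S.form x x ∧ 2 * S.form x y = -2 * S.form y y) ∨
    (2 * S.form x y = -2 * S.form x x ∧ 2 * S.form x y = -S.form y y) ∨
    (2 * S.form x y = -2 * S.form x x ∧ 2 * S.form x y = -2 * S.form y y) := by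
  have hX := S.form_self_pos hx
  have hY := S.form_self_pos hy
  have hp := S.pairing_mem hx hy
  rw [S.form_comm y x] at hp
  simp only [Set.mem_insert_iff, Set.mem_singleton_iff, Prod.mk.injEq, div_eq_iff hX.ne',
    div_eq_iff hY.ne'] at hp
  rcases hp with h | h | h | h | h | h | h | h | h
  on_goal 6 => left; constructor <;> linarith
  on_goal 6 => right; right; left; constructor <;> linarith
  on_goal 6 => right; left; constructor <;> linarith
  on_goal 6 => right; right; right; constructor <;> linarith
  all_goals linarith

/-- The possible Cartan integers of an acute pair of roots. -/
lemma form_cases_of_pos {x y : V} (hx : x ∈ S.roots) (hy : y ∈ S.roots) (h : 0 < S.form x y) :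
    (2 * S.form x y = S.form x x ∧ 2 * S.form x y = S.form y y) ∨
    (2 * S.form x y = S.form x x ∧ 2 * S.form x y = 2 * S.form y y) ∨
    (2 * S.form x y = 2 * S.form x x ∧ 2 * S.form x y = S.form y y) ∨
    (2 * S.form x y = 2 * S.form x x ∧ 2 * S.form x y = 2 * S.form y y) := by
  have hX := S.form_self_pos hx
  have hY := S.form_self_pos hy
  have hp := S.pairing_mem hx hy
  rw [S.form_comm y x] at hp
  simp only [Set.mem_insert_iff, Set.mem_singleton_iff, Prod.mk.injEq, div_eq_iff hX.ne',
    div_eq_iff hY.ne'] at hp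
  rcases hp with h | h | h | h | h | h | h | h | h
  on_goal 2 => left; constructor <;> linarith
  on_goal 2 => right; right; left; constructor <;> linarith
  on_goal 2 => right; left; constructor <;> linarith
  on_goal 2 => right; right; right; constructor <;> linarith
  all_goals linarith

lemma form_le_of_neg {x y : V} (hx : x ∈ S.roots) (hy : y ∈ S.roots) (h : S.form x y < 0) :
    S.form x y ≤ -S.form x x / 2 ∧ S.form x y ≤ -S.form y y / 2 := by
  have hX := S.form_self_pos hx
  have hY := S.form_self_pos hy
  rcases form_cases_of_neg hx hy h with h | h | h | h <;> constructor <;> linarith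

lemma le_form_of_pos {x y : V} (hx : x ∈ S.roots) (hy : y ∈ S.roots) (h : 0 < S.form x y) :
    S.form x x / 2 ≤ S.form x y ∧ S.form y y / 2 ≤ S.form x y := by
  have hX := S.form_self_pos hx
  have hY := S.form_self_pos hy
  rcases form_cases_of_pos hx hy h with h | h | h | h <;> constructor <;> linarith

lemma braid_three {i j : I} (h : S.pairing (S.simple i) j * S.pairing (S.simple j) i = 1) :
    S.refl i * S.refl j * S.refl i = S.refl j * S.refl i * S.refl j := by
  ext x
  simp only [LinearEquiv.mul_apply, refl_apply, pairing_sub, pairing_smul, pairing_self]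
  generalize S.pairing (S.simple i) j = p at *
  generalize S.pairing (S.simple j) i = q at *
  match_scalars
  · ring
  · linear_combination (-S.pairing x i) * h
  · linear_combination (S.pairing x j) * h

lemma braid_four {i j : I} (h : S.pairing (S.simple i) j * S.pairing (S.simple j) i = 2) :
    S.refl i * S.refl j * S.refl i * S.refl j = S.refl j * S.refl i * S.refl j * S.refl i := by
  ext x
  simp only [LinearEquiv.mul_apply, refl_apply, pairing_sub, pairing_smul, pairing_self]
  generalize S.pairing (S.simple i) j = p at *
  generalize S.pairing (S.simple j) i = q at *
  match_scalars
  · ring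
  · linear_combination (-S.pairing x i * p) * h
  · linear_combination (S.pairing x j * q) * h

lemma orderOf_eq_three {i j : I} (hc : ¬ Commute (S.refl i) (S.refl j))
    (h : S.pairing (S.simple i) j * S.pairing (S.simple j) i = 1) :
    orderOf (S.refl i * S.refl j) = 3 := by
  refine orderOf_eq_prime ?_ fun h1 ↦ hc ?_
  · have : (S.refl i * S.refl j) ^ 3 =
        (S.refl i * S.refl j * S.refl i) * (S.refl j * S.refl i * S.refl j) := by
      simp only [pow_succ, pow_zero, one_mul, mul_assoc]
    rw [this, ← braid_three h]
    simp only [mul_assoc, ← mul_assoc (S.refl i) (S.refl i), refl_mul_self, one_mul,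
      ← mul_assoc (S.refl j) (S.refl j)]
  · rw [mul_eq_one_iff_eq_inv.1 h1, refl_inv]

lemma orderOf_eq_four {i j : I} (hc : ¬ Commute (S.refl i) (S.refl j))
    (h : S.pairing (S.simple i) j * S.pairing (S.simple j) i = 2) :
    orderOf (S.refl i * S.refl j) = 4 := by
  have hsq : (S.refl j * S.refl i) ^ 2 = ((S.refl i * S.refl j) ^ 2)⁻¹ := by
    rw [← inv_pow]; simp [refl_inv]
  refine orderOf_eq_prime_pow (p := 2) (n := 1) (fun h1 ↦ hc ?_) ?_
  · have : S.refl i * S.refl j = (S.refl i * S.refl j)⁻¹ := by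
      rw [eq_inv_iff_mul_eq_one, ← sq]; simpa using h1
    rw [mul_inv_rev, refl_inv, refl_inv] at this
    exact this
  · have h2 : (S.refl i * S.refl j) ^ 2 = (S.refl j * S.refl i) ^ 2 := by
      simpa only [pow_succ, pow_zero, one_mul, mul_assoc] using braid_four h
    have : (S.refl i * S.refl j) ^ 2 ^ (1 + 1) =
      (S.refl i * S.refl j) ^ 2 * (S.refl i * S.refl j) ^ 2 := by rw [← pow_add]; norm_num
    rw [this]
    nth_rewrite 1 [h2]
    rw [hsq, inv_mul_cancel]

/-! ### Braids at the end of a reduced word -/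

lemma mul_refl_mem_range {w : V ≃ₗ[ℝ] V} (hw : w ∈ Set.range S.wordProd) (i : I) :
    w * S.refl i ∈ Set.range S.wordProd := by
  obtain ⟨l, rfl⟩ := hw
  exact ⟨l ++ [i], by simp⟩

/-- A reduced word of `w s_i` with prescribed end `m` extends to a reduced word of `w` ending in
`m ++ [i]`, if `i` is a right descent of `w`. -/
lemma exists_isReduced_append {w : V ≃ₗ[ℝ] V} (hw : w ∈ Set.range S.wordProd) {i : I}
    (hi : S.ht (w (S.simple i)) < 0) {m : List I}
    (h : ∃ l, S.IsReduced (w * S.refl i) (l ++ m)) : ∃ l, S.IsReduced w (l ++ (m ++ [i])) := by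
  obtain ⟨l₀, rfl⟩ := hw
  obtain ⟨l, hl⟩ := h
  exact ⟨l, by simpa using IsReduced.append_singleton hi hl⟩

lemma exists_isReduced_append_nil {w : V ≃ₗ[ℝ] V} (hw : w ∈ Set.range S.wordProd) :
    ∃ l, S.IsReduced w (l ++ []) := by
  obtain ⟨l₀, rfl⟩ := hw
  simpa using S.exists_isReduced l₀

lemma IsFullyCommutative.mul_refl {w : V ≃ₗ[ℝ] V} (hw : w ∈ Set.range S.wordProd)
    (h : S.IsFullyCommutative w) {i : I} (hi : S.ht (w (S.simple i)) < 0) :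
    S.IsFullyCommutative (w * S.refl i) := by
  obtain ⟨l₀, rfl⟩ := hw
  intro l hl j k hc hm hinf
  exact h _ (IsReduced.append_singleton hi hl) j k hc hm
    (hinf.trans (List.prefix_append l [i]).isInfix)

/-- A fully commutative element has no reduced word that ends in `i j i` with `m (i, j) = 3`; the
hypotheses say that `i`, `j`, `i` are successive right descents. -/
lemma IsFullyCommutative.false_of_three {w : V ≃ₗ[ℝ] V} (hw : w ∈ Set.range S.wordProd)
    (h : S.IsFullyCommutative w) {i j : I} (hij : S.form (S.simple i) (S.simple j) < 0)
    (hp : S.pairing (S.simple i) j * S.pairing (S.simple j) i = 1)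
    (h1 : S.ht (w (S.simple i)) < 0) (h2 : S.ht (w (S.refl i (S.simple j))) < 0)
    (h3 : S.ht (w (S.refl i (S.refl j (S.simple i)))) < 0) : False := by
  have hw1 := mul_refl_mem_range hw i
  have hw2 := mul_refl_mem_range hw1 j
  obtain ⟨l, hl⟩ := exists_isReduced_append hw h1 <| exists_isReduced_append hw1 h2 <|
    exists_isReduced_append hw2 h3 <| exists_isReduced_append_nil <| mul_refl_mem_range hw2 i
  have hc := S.not_commute_of_form_neg hij
  have ho := orderOf_eq_three (fun h ↦ hc h.symm) (by rwa [mul_comm])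
  refine h _ hl j i (fun h ↦ hc h.symm) (by simp [ho]) ?_
  rw [ho]
  exact (List.suffix_append l _).isInfix

/-- The analogue of `false_of_three` for `m (i, j) = 4`. -/
lemma IsFullyCommutative.false_of_four {w : V ≃ₗ[ℝ] V} (hw : w ∈ Set.range S.wordProd)
    (h : S.IsFullyCommutative w) {i j : I} (hij : S.form (S.simple i) (S.simple j) < 0)
    (hp : S.pairing (S.simple i) j * S.pairing (S.simple j) i = 2)
    (h1 : S.ht (w (S.simple i)) < 0) (h2 : S.ht (w (S.refl i (S.simple j))) < 0)
    (h3 : S.ht (w (S.refl i (S.refl j (S.simple i)))) < 0)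
    (h4 : S.ht (w (S.refl i (S.refl j (S.refl i (S.simple j))))) < 0) : False := by
  have hw1 := mul_refl_mem_range hw i
  have hw2 := mul_refl_mem_range hw1 j
  have hw3 := mul_refl_mem_range hw2 i
  obtain ⟨l, hl⟩ := exists_isReduced_append hw h1 <| exists_isReduced_append hw1 h2 <|
    exists_isReduced_append hw2 h3 <| exists_isReduced_append hw3 h4 <|
    exists_isReduced_append_nil <| mul_refl_mem_range hw3 j
  have hc := S.not_commute_of_form_neg hij
  have ho := orderOf_eq_four (fun h ↦ hc h.symm) (by rwa [mul_comm])
  refine h _ hl j i (fun h ↦ hc h.symm) (by simp [ho]) ?_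
  rw [ho]
  exact (List.suffix_append l _).isInfix

lemma apply_of_form_eq_zero {w : V ≃ₗ[ℝ] V} (hw : w ∈ Set.range S.wordProd) {x : V}
    (hx : S.form x x = 0) : w x = x := by
  obtain ⟨l, rfl⟩ := hw
  exact S.wordProd_of_form_eq_zero l (S.form_eq_zero_of_self hx)

/-- The possible Cartan integers of two non-orthogonal simple roots. -/
lemma pairing_simple_cases {i j : I} (h : S.form (S.simple i) (S.simple j) < 0) :
    (S.pairing (S.simple i) j = -1 ∧ S.pairing (S.simple j) i = -1) ∨
    (S.pairing (S.simple i) j = -1 ∧ S.pairing (S.simple j) i = -2) ∨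
    (S.pairing (S.simple i) j = -2 ∧ S.pairing (S.simple j) i = -1) ∨
    (S.pairing (S.simple i) j = -2 ∧ S.pairing (S.simple j) i = -2) := by
  have hp := S.pairing_mem (S.simple_mem i) (S.simple_mem j)
  have h1 : S.pairing (S.simple i) j < 0 :=
    div_neg_of_neg_of_pos (by linarith) (S.form_simple_pos j)
  simp only [Set.mem_insert_iff, Set.mem_singleton_iff, Prod.mk.injEq] at hp
  simp only [pairing] at h1 ⊢
  rcases hp with h | h | h | h | h | h | h | h | h
  on_goal 6 => exact Or.inl h
  on_goal 6 => exact Or.inr (Or.inl h)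
  on_goal 6 => exact Or.inr (Or.inr (Or.inl h))
  on_goal 6 => exact Or.inr (Or.inr (Or.inr h))
  all_goals (rw [h.1] at h1; norm_num at h1)

/-- Two right descents of a fully commutative element commute: `w` makes every non-negative
combination of the two simple roots negative, so a reduced word of `w` can end in the braid. -/
lemma IsFullyCommutative.false_of_two_descents {w : V ≃ₗ[ℝ] V} (hw : w ∈ Set.range S.wordProd)
    (h : S.IsFullyCommutative w) {i j : I} (hij : S.form (S.simple i) (S.simple j) < 0)
    (hi : S.ht (w (S.simple i)) < 0) (hj : S.ht (w (S.simple j)) < 0) : False := by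
  have key (a c : ℝ) (ha : 0 ≤ a) (hc : 0 ≤ c) (hac : 0 < a + c) :
      S.ht (w (a • S.simple i + c • S.simple j)) < 0 := by
    simp only [map_add, map_smul, smul_eq_mul]
    rcases ha.eq_or_lt with rfl | ha
    · nlinarith
    · nlinarith
  rcases pairing_simple_cases hij with ⟨h1, h2⟩ | ⟨h1, h2⟩ | ⟨h1, h2⟩ | ⟨h1, h2⟩
  · refine h.false_of_three hw hij (by norm_num [h1, h2]) hi ?_ ?_
    · convert! key 1 1 (by norm_num) (by norm_num) (by norm_num) using 3
      rw [refl_apply, h2]; module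
    · convert! hj using 3
      simp only [refl_apply, pairing_sub, pairing_smul, pairing_self, h1, h2]; module
  · refine h.false_of_four hw hij (by norm_num [h1, h2]) hi ?_ ?_ ?_
    · convert! key 2 1 (by norm_num) (by norm_num) (by norm_num) using 3
      rw [refl_apply, h2]; module
    · convert! key 1 1 (by norm_num) (by norm_num) (by norm_num) using 3
      simp only [refl_apply, pairing_sub, pairing_smul, pairing_self, h1, h2]; module
    · convert! hj using 3
      simp only [refl_apply, pairing_sub, pairing_smul, pairing_self, h1, h2]; module
  · refine h.false_of_four hw hij (by norm_num [h1, h2]) hi ?_ ?_ ?_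
    · convert! key 1 1 (by norm_num) (by norm_num) (by norm_num) using 3
      rw [refl_apply, h2]; module
    · convert! key 1 2 (by norm_num) (by norm_num) (by norm_num) using 3
      simp only [refl_apply, pairing_sub, pairing_smul, pairing_self, h1, h2]; module
    · convert! hj using 3
      simp only [refl_apply, pairing_sub, pairing_smul, pairing_self, h1, h2]; module
  · -- Here `α i + α j` lies in the radical of the form, so `w` fixes it.
    have e1 := S.pairing_mul (S.simple i) j
    have e2 := S.pairing_mul (S.simple j) i
    have e3 := S.form_comm (S.simple i) (S.simple j)
    have := apply_of_form_eq_zero hw (x := S.simple i + S.simple j) (by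
      simp only [map_add, LinearMap.add_apply]
      rw [h1] at e1; rw [h2] at e2
      linarith)
    have h3 := congrArg S.ht this
    simp only [map_add] at h3
    linarith [S.ht_simple_pos i, S.ht_simple_pos j]

/-! ### The smallest obtuse pair of inversions -/

/-- A smallest possible counterexample to the acuteness of inversions: `w` is fully commutative,
`i` is a right descent, `y` is an inversion at an obtuse angle with `α i`, and all obtuse pairs of
inversions involve every simple root that is an inversion. (Otherwise the pair would survive the
removal of a last letter from a reduced word.) -/
structure IsMinimalObtuse (S : ReflectionSystem I V) (w : V ≃ₗ[ℝ] V) (i : I) (y : V) : Prop where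
  mem_range : w ∈ Set.range S.wordProd
  fc : S.IsFullyCommutative w
  descent : S.ht (w (S.simple i)) < 0
  mem : y ∈ S.inversions w
  neg : S.form y (S.simple i) < 0
  nonneg : ∀ k, S.ht (w (S.simple k)) < 0 → ∀ x ∈ S.inversions w, ∀ z ∈ S.inversions w,
    x ≠ S.simple k → z ≠ S.simple k → 0 ≤ S.form x z

namespace IsMinimalObtuse

variable {w : V ≃ₗ[ℝ] V} {i : I} {y : V}

lemma eq_of_descent (h : S.IsMinimalObtuse w i y) {k : I} (hk : S.ht (w (S.simple k)) < 0) :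
    k = i := by
  by_contra hki
  have hne : S.simple i ≠ S.simple k := fun h ↦ hki (S.simple_injective h).symm
  by_cases hy : y = S.simple k
  · have := h.neg
    rw [hy] at this
    exact h.fc.false_of_two_descents h.mem_range this hk h.descent
  · exact absurd h.neg (h.nonneg k hk _ h.mem _ ⟨S.simple_mem i, S.ht_simple_pos i, h.descent⟩
      hy hne).not_gt

end IsMinimalObtuse

/-! ### The second and third letters -/

variable (S) in
lemma refl_ne_simple {i : I} {x : V} (hx : 0 < S.ht x) : S.refl i x ≠ S.simple i := fun h ↦ by
  have := congrArg (fun v ↦ S.ht (S.refl i v)) h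
  simp only [refl_refl, refl_simple, map_neg] at this
  linarith [S.ht_simple_pos i]

/-- The inner products forced by a right descent `k` of `w s_i`, where `(w, i, y)` is a smallest
obtuse configuration: `k` is the second letter from the right of a reduced word of `w`. Here `-p` is
the Cartan number `⟨α i, α k⟩`. -/
structure IsSecondLetter (S : ReflectionSystem I V) (w : V ≃ₗ[ℝ] V) (i : I) (y : V) (k : I)
    (p : ℝ) : Prop where
  descent : S.ht (w (S.refl i (S.simple k))) < 0
  ht_pos : 0 < S.ht (w (S.simple k))
  eq_or : p = 1 ∨ p = 2
  form_ii : S.form (S.simple i) (S.simple i) = p ^ 2 * S.form (S.simple k) (S.simple k) / 2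
  form_yy : S.form y y = p ^ 2 * S.form (S.simple k) (S.simple k) / 2
  form_ik : S.form (S.simple i) (S.simple k) = - p * S.form (S.simple k) (S.simple k) / 2
  form_yi : S.form y (S.simple i) = - p ^ 2 * S.form (S.simple k) (S.simple k) / 4
  form_yk : S.form y (S.simple k) = p * S.form (S.simple k) (S.simple k) / 2

/-- The inner products forced by a right descent `l` of `w s_i s_k`, the third letter from the right
of a reduced word of `w`. -/
structure IsThirdLetter (S : ReflectionSystem I V) (y : V) (i k l : I) : Prop where
  form_ll : S.form (S.simple l) (S.simple l) = S.form (S.simple k) (S.simple k)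
  form_li : S.form (S.simple l) (S.simple i) = 0
  form_lk : S.form (S.simple l) (S.simple k) = - S.form (S.simple k) (S.simple k) / 2
  form_ly : S.form (S.simple l) y = 0

/-- The numerical inequality that contradicts the Cauchy–Schwarz inequality whenever the third
letter fails to be orthogonal to `α i` or `y`. -/
lemma mul_lt_sq_sub {p g t L N M : ℝ} (hp : p = 1 ∨ p = 2) (hN : 0 < N) (hL : 0 < L)
    (h1 : t ≤ -L / 2) (h2 : t ≤ -N / 2) (h3 : L / 2 ≤ g) (h4 : M / 2 ≤ g)
    (hM : M = p ^ 2 * N / 2) : M * L < (g - p * t) ^ 2 := by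
  subst hM
  rcases hp with rfl | rfl
  · nlinarith [mul_pos hN hL]
  · nlinarith [mul_pos hN hL]

/-- For roots the ratio `(x, y) ^ 2 / ((x, x) (y, y))` is one of `0`, `1 / 4`, `1 / 2`, `1`, so a
bound by `3 / 8` forces the simply laced case. -/
lemma form_eq_of_neg_of_sq_le {x y : V} (hx : x ∈ S.roots) (hy : y ∈ S.roots)
    (h : S.form x y < 0) (hs : S.form x y ^ 2 * 8 ≤ 3 * (S.form y y * S.form x x)) :
    S.form x x = S.form y y ∧ S.form x y = -S.form y y / 2 := by
  have hX := S.form_self_pos hx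
  have hY := S.form_self_pos hy
  have hXY := mul_pos hX hY
  rcases form_cases_of_neg hx hy h with ⟨b, c⟩ | ⟨b, c⟩ | ⟨b, c⟩ | ⟨b, c⟩
  · constructor <;> linarith
  all_goals
    exfalso
    have : 4 * S.form x y ^ 2 = (2 * S.form x y) * (2 * S.form x y) := by ring
    nth_rewrite 2 [c] at this
    rw [b] at this
    linarith

variable (S) in
/-- The Cauchy–Schwarz inequality for `x + c z` and `v`. -/
lemma form_add_smul_sq_le (x z v : V) (c : ℝ) : (S.form x v + c * S.form z v) ^ 2 ≤
    (S.form x x + 2 * c * S.form x z + c ^ 2 * S.form z z) * S.form v v := by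
  have := S.form_sq_le (x + c • z) v
  simp only [map_add, map_smul, LinearMap.add_apply, LinearMap.smul_apply, smul_eq_mul,
    S.form_comm z x] at this
  linarith

lemma pairing_eq_of {x : V} {i : I} {c : ℝ}
    (h : 2 * S.form x (S.simple i) = c * S.form (S.simple i) (S.simple i)) : S.pairing x i = c :=
  (div_eq_iff (S.form_simple_pos i).ne').2 h

/-- A right descent of `w s_i` differs from `i`. -/
lemma ne_of_ht_refl_neg {w : V ≃ₗ[ℝ] V} {i j : I} (hi : S.ht (w (S.simple i)) < 0)
    (hj : S.ht (w (S.refl i (S.simple j))) < 0) : j ≠ i := by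
  rintro rfl
  rw [refl_simple, map_neg, map_neg] at hj
  linarith

namespace IsMinimalObtuse

variable {w : V ≃ₗ[ℝ] V} {i : I} {y : V}

lemma form_nonneg (h : S.IsMinimalObtuse w i y) {x z : V} (hx : x ∈ S.inversions w)
    (hz : z ∈ S.inversions w) (hxi : x ≠ S.simple i) (hzi : z ≠ S.simple i) : 0 ≤ S.form x z :=
  h.nonneg i h.descent x hx z hz hxi hzi

lemma ne_simple (h : S.IsMinimalObtuse w i y) : y ≠ S.simple i := fun hy ↦ by
  have := h.neg
  rw [hy] at this
  exact absurd this (S.form_simple_pos i).not_gt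

/-- The pairs of inversions `y`, `s_i (α k)` and `s_k y`, `s_i (α k)` are not obtuse; this leaves
two possibilities, in which `α i` and `α k` have different lengths. -/
lemma exists_isSecondLetter (h : S.IsMinimalObtuse w i y) {k : I}
    (hk : S.ht (w (S.refl i (S.simple k))) < 0) : ∃ p, S.IsSecondLetter w i y k p := by
  suffices 0 < S.ht (w (S.simple k)) ∧ S.form (S.simple i) (S.simple k) < 0 ∧
      ∃ p : ℝ, (p = 1 ∨ p = 2) ∧
      S.form (S.simple i) (S.simple i) = p ^ 2 * S.form (S.simple k) (S.simple k) / 2 ∧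
      S.form y y = p ^ 2 * S.form (S.simple k) (S.simple k) / 2 ∧
      S.form (S.simple i) (S.simple k) = - p * S.form (S.simple k) (S.simple k) / 2 ∧
      S.form y (S.simple i) = - p ^ 2 * S.form (S.simple k) (S.simple k) / 4 ∧
      S.form y (S.simple k) = p * S.form (S.simple k) (S.simple k) / 2 by
    obtain ⟨h1, -, p, hp, h2, h3, h4, h5, h6⟩ := this
    exact ⟨p, hk, h1, hp, h2, h3, h4, h5, h6⟩
  obtain ⟨l, hl⟩ := h.mem_range
  have hki : k ≠ i := by
    rintro rfl
    rw [refl_simple, map_neg, map_neg] at hk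
    linarith [h.descent]
  have hwk : 0 < S.ht (w (S.simple k)) := by
    refine (S.ht_pos_or_neg (by rw [← hl]; exact S.wordProd_mem _ (S.simple_mem k))).resolve_right
      fun hn ↦ hki (h.eq_of_descent hn)
  have hik : S.form (S.simple i) (S.simple k) < 0 := by
    refine (S.form_simple_le hki.symm).lt_of_ne fun h0 ↦ ?_
    rw [S.refl_of_form_eq_zero (by rwa [form_comm])] at hk
    linarith
  refine ⟨hwk, hik, ?_⟩
  have hki' : S.form (S.simple k) (S.simple i) < 0 := by rwa [form_comm]
  have hyk : y ≠ S.simple k := fun hy ↦ by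
    have := h.mem.2.2
    rw [hy] at this
    linarith
  -- the inversion `γ = s_i (α k)`
  have hγ : S.refl i (S.simple k) ∈ S.inversions w :=
    ⟨S.refl_mem i (S.simple_mem k),
      S.ht_refl_pos i (S.simple_mem k) (S.ht_simple_pos k) (S.simple_injective.ne hki), hk⟩
  have hγi : S.refl i (S.simple k) ≠ S.simple i := S.refl_ne_simple (S.ht_simple_pos k)
  have c1 : 0 ≤ S.form y (S.refl i (S.simple k)) := h.form_nonneg h.mem hγ h.ne_simple hγi
  have e1 := S.pairing_mul (S.simple i) k
  have e2 := S.pairing_mul (S.simple k) i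
  have e3 := S.form_comm (S.simple k) (S.simple i)
  have hN := S.form_simple_pos k
  have hNi := S.form_simple_pos i
  have hNy := S.form_self_pos h.mem.1
  have c1' := c1
  rw [refl_apply, map_sub, map_smul, smul_eq_mul] at c1'
  have hneg := h.neg
  have hp : S.pairing (S.simple k) i < 0 :=
    div_neg_of_neg_of_pos (by linarith) hNi
  have hyk' : 0 < S.form y (S.simple k) := by nlinarith
  -- the inversion `z = s_k y`
  have hz : S.refl k y ∈ S.inversions w := by
    refine ⟨S.refl_mem k h.mem.1, S.ht_refl_pos k h.mem.1 h.mem.2.1 hyk, ?_⟩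
    have : 0 < S.pairing y k := div_pos (by linarith) hN
    rw [refl_apply, map_sub, map_sub, map_smul, map_smul, smul_eq_mul]
    nlinarith [h.mem.2.2]
  have c2 : 0 ≤ S.form (S.refl k y) (S.refl i (S.simple k)) := by
    by_cases hzi : S.refl k y = S.simple i
    · rw [hzi, ← form_refl_left, refl_simple, map_neg, LinearMap.neg_apply]
      linarith
    · exact h.form_nonneg hz hγ hzi hγi
  simp only [refl_apply, map_sub, map_smul, smul_eq_mul, LinearMap.sub_apply,
    LinearMap.smul_apply] at c2
  -- `y` does not agree with `α k` modulo the radical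
  have hrad : S.form (y - S.simple k) (y - S.simple k) ≠ 0 := fun h0 ↦ by
    have h1 := congrArg S.ht (apply_of_form_eq_zero h.mem_range h0)
    have h2 := S.ht_simple_le k h.mem.1 h.mem.2.1 h0
    simp only [map_sub] at h1
    linarith [h.mem.2.2]
  have hrad2 : S.form (S.simple i + S.simple k) (S.simple i + S.simple k) = 0 →
      S.form (S.simple i) y + S.form (S.simple k) y = 0 := fun h0 ↦ by
    have := S.form_eq_zero_of_self h0 y
    simpa using this
  simp only [map_add, map_sub, LinearMap.add_apply, LinearMap.sub_apply, e3,
    S.form_comm (S.simple k) y, S.form_comm (S.simple i) y] at hrad hrad2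
  have q1 := form_cases_of_neg h.mem.1 (S.simple_mem i) h.neg
  have q2 := form_cases_of_pos h.mem.1 (S.simple_mem k) hyk'
  have e4 : S.pairing y k * S.form (S.simple k) (S.simple k) = 2 * S.form y (S.simple k) :=
    S.pairing_mul y k
  have e5 : S.pairing y k * S.form (S.simple i) (S.simple k) =
      S.pairing (S.simple i) k * S.form y (S.simple k) := by
    linear_combination (S.pairing (S.simple i) k / 2) * e4 - (S.pairing y k / 2) * e1
  rw [e4, e3, e5] at c2
  rw [e3] at e2
  -- The Cartan numbers `(-1, -2)` and `(-2, -1)` give the two possibilities for `p`.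
  rcases pairing_simple_cases hik with ⟨h1, h2⟩ | ⟨h1, h2⟩ | ⟨h1, h2⟩ | ⟨h1, h2⟩ <;>
    rw [h1] at e1 c2 <;> rw [h2] at e2 c1' c2
  · linarith
  · refine ⟨1, Or.inl rfl, ?_⟩
    rcases q1 with q1 | q1 | q1 | q1 <;> rcases q2 with q2 | q2 | q2 | q2 <;>
    first
    | exact absurd (by linarith) hrad
    | exact ⟨by linarith, by linarith, by linarith, by linarith, by linarith⟩
  · refine ⟨2, Or.inr rfl, ?_⟩
    rcases q1 with q1 | q1 | q1 | q1 <;> rcases q2 with q2 | q2 | q2 | q2 <;>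
    first
    | exact absurd (by linarith) hrad
    | exact ⟨by linarith, by linarith, by linarith, by linarith, by linarith⟩
  · linarith [hrad2 (by linarith)]

end IsMinimalObtuse

namespace IsSecondLetter

variable {w : V ≃ₗ[ℝ] V} {i k : I} {y : V} {p : ℝ}

lemma refl_eq_add (h2 : S.IsSecondLetter w i y k p) : S.refl i y = y + S.simple i := by
  rw [refl_apply, pairing_eq_of (c := -1)]
  · module
  · rw [h2.form_yi, h2.form_ii]; ring

/-- The inversion `y` becomes `y + α i` after removing the last letter `i`; this root is orthogonal
to `α k`. -/
lemma form_simple_add (h2 : S.IsSecondLetter w i y k p) :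
    S.form (S.simple k) (y + S.simple i) = 0 := by
  rw [map_add, S.form_comm _ y, S.form_comm _ (S.simple i), h2.form_yk, h2.form_ik]; ring

lemma refl_add (h2 : S.IsSecondLetter w i y k p) : S.refl k (y + S.simple i) = y + S.simple i :=
  S.refl_of_form_eq_zero (by rw [form_comm, h2.form_simple_add])

end IsSecondLetter

namespace IsMinimalObtuse

variable {w : V ≃ₗ[ℝ] V} {i k : I} {y : V} {p : ℝ}

/-- The third letter is attached to `α k` by a simple bond and orthogonal to `α i` and `y`. The
inversion `s_i s_k (α l)` is not obtuse to `y`; combined with the Cauchy–Schwarz inequality for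
`α l` and the vectors `s_k (α i)`, `y - s_k (α i)` and `s_k (α i) - y / 2`, this determines all
inner products. -/
lemma isThirdLetter (h : S.IsMinimalObtuse w i y) (h2 : S.IsSecondLetter w i y k p) {l : I}
    (hl : S.ht (w (S.refl i (S.refl k (S.simple l)))) < 0) : S.IsThirdLetter y i k l := by
  have hN := S.form_simple_pos k
  have hL := S.form_simple_pos l
  have hp : 0 < p := by rcases h2.eq_or with rfl | rfl <;> norm_num
  have hik : S.form (S.simple i) (S.simple k) < 0 := by rw [h2.form_ik]; nlinarith
  have hlk : l ≠ k := ne_of_ht_refl_neg (w := w * S.refl i) h2.descent hl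
  have hkp : S.pairing (S.simple i) k = -p := pairing_eq_of (by rw [h2.form_ik]; ring)
  have hu : S.refl k (S.simple i) = S.simple i + p • S.simple k := by
    rw [refl_apply, hkp]; module
  have hui : S.form (S.refl k (S.simple i)) (S.simple i) = 0 := by
    rw [hu, map_add, map_smul, LinearMap.add_apply, LinearMap.smul_apply, smul_eq_mul,
      S.form_comm (S.simple k), h2.form_ik, h2.form_ii]; ring
  have hwy := h.mem.2.2
  -- `l = i` would produce the obtuse pair of inversions `s_k (α i)`, `s_k y`.
  have hli : l ≠ i := by
    rintro rfl
    rw [S.refl_of_form_eq_zero hui] at hl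
    have hyk : y ≠ S.simple k := by
      rintro rfl
      linarith [h2.ht_pos]
    have hpy : S.pairing y k = p := pairing_eq_of (by rw [h2.form_yk]; ring)
    have hz : S.refl k y ∈ S.inversions w := by
      refine ⟨S.refl_mem k h.mem.1, S.ht_refl_pos k h.mem.1 h.mem.2.1 hyk, ?_⟩
      rw [refl_apply, hpy, map_sub, map_sub, map_smul, map_smul, smul_eq_mul]
      nlinarith [h2.ht_pos]
    have hz' : S.refl k (S.simple l) ∈ S.inversions w :=
      ⟨S.refl_mem k (S.simple_mem l), S.ht_refl_pos_of_form_nonpos (S.ht_simple_pos l) hik.le, hl⟩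
    refine absurd h.neg (not_lt.2 ?_)
    rw [← S.form_refl_refl k]
    refine h.form_nonneg hz hz' (fun he ↦ ?_) (fun he ↦ ?_)
    · have := h.neg
      rw [← S.form_refl_refl k, he, form_comm, hui] at this
      exact this.false
    · rw [he] at hui
      linarith [S.form_simple_pos l]
  -- `l` cannot commute with `k`: otherwise `y` would be `(p / 2) α k + (q / 2) α l`
  -- modulo the radical.
  have hkl : S.form (S.simple l) (S.simple k) < 0 := by
    refine (S.form_simple_le hlk).lt_of_ne fun h0 ↦ ?_
    rw [S.refl_of_form_eq_zero h0] at hl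
    obtain ⟨q, h2'⟩ := h.exists_isSecondLetter hl
    have e := S.form_eq_zero_of_self
      (x := y - (p / 2) • S.simple k - (q / 2) • S.simple l) (y := S.simple i) (by
        simp only [map_sub, map_smul, LinearMap.sub_apply, LinearMap.smul_apply, smul_eq_mul, h0,
          S.form_comm (S.simple k) (S.simple l), S.form_comm (S.simple k) y,
          S.form_comm (S.simple l) y, h2.form_yk, h2'.form_yk]
        linear_combination (1 / 2 : ℝ) * h2.form_yy + (1 / 2 : ℝ) * h2'.form_yy)
    simp only [map_sub, map_smul, LinearMap.sub_apply, LinearMap.smul_apply, smul_eq_mul,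
      S.form_comm (S.simple k) (S.simple i), S.form_comm (S.simple l) (S.simple i),
      h2.form_ik, h2'.form_ik] at e
    nlinarith [h2.form_yi, h2'.form_yi, h2.form_yy, h2'.form_yy, S.form_self_pos h.mem.1]
  have hil := S.form_simple_le hli
  -- the inversion `γ = s_i s_k (α l)`
  have hg : 0 < S.ht (S.refl k (S.simple l)) :=
    S.ht_refl_pos_of_form_nonpos (S.ht_simple_pos l) hkl.le
  have hγ : S.refl i (S.refl k (S.simple l)) ∈ S.inversions w := by
    refine ⟨S.refl_mem i (S.refl_mem k (S.simple_mem l)), ?_, hl⟩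
    refine S.ht_refl_pos_of_form_nonpos hg ?_
    have : S.pairing (S.simple l) k < 0 := div_neg_of_neg_of_pos (by linarith) hN
    rw [refl_apply, map_sub, map_smul, LinearMap.sub_apply, LinearMap.smul_apply, smul_eq_mul,
      S.form_comm (S.simple k)]
    nlinarith
  have c := h.form_nonneg hγ h.mem (S.refl_ne_simple hg) h.ne_simple
  rw [form_refl_left, form_refl_left, h2.refl_eq_add, h2.refl_add, map_add] at c
  have b1 := form_le_of_neg (S.simple_mem l) (S.simple_mem k) hkl
  -- bound obtained from the inner product of `α l` with a root of the length of `α i`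
  have key (g : ℝ) (h1 : S.form (S.simple l) (S.simple l) / 2 ≤ g)
      (h3 : S.form (S.simple i) (S.simple i) / 2 ≤ g)
      (hs : (g - p * S.form (S.simple l) (S.simple k)) ^ 2 ≤
        S.form (S.simple i) (S.simple i) * S.form (S.simple l) (S.simple l)) : False := by
    exact absurd hs (not_le.2 (mul_lt_sq_sub h2.eq_or hN hL b1.1 b1.2 h1 h3 h2.form_ii))
  have hul : S.form (S.refl k (S.simple i)) (S.simple l) =
      S.form (S.simple l) (S.simple i) + p * S.form (S.simple l) (S.simple k) := by
    rw [hu, S.form_comm, map_add, map_smul, smul_eq_mul]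
  have hli0 : S.form (S.simple l) (S.simple i) = 0 := by
    by_contra h0
    obtain ⟨d1, d2⟩ := form_le_of_neg (S.simple_mem l) (S.simple_mem i) (hil.lt_of_ne h0)
    refine key (-S.form (S.simple l) (S.simple i)) (by linarith) (by linarith) ?_
    have := S.form_sq_le (S.refl k (S.simple i)) (S.simple l)
    rw [form_refl_refl, hul] at this
    linarith
  have huy : S.form y (S.refl k (S.simple i)) = S.form (S.simple i) (S.simple i) / 2 := by
    rw [hu, map_add, map_smul, smul_eq_mul, h2.form_yk, h2.form_yi, h2.form_ii]; ring
  have hly0 : S.form (S.simple l) y = 0 := by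
    by_contra h0
    rw [hli0, add_zero] at c
    obtain ⟨d1, d2⟩ := le_form_of_pos (S.simple_mem l) h.mem.1 (c.lt_of_ne' h0)
    refine key (S.form (S.simple l) y) d1 (by rw [h2.form_ii, ← h2.form_yy]; exact d2) ?_
    have := S.form_add_smul_sq_le y (S.refl k (S.simple i)) (S.simple l) (-1)
    rw [huy, form_refl_refl, h2.form_yy, ← h2.form_ii, S.form_comm y, hul, hli0] at this
    linarith
  have cs := S.form_add_smul_sq_le (S.refl k (S.simple i)) y (S.simple l) (-1 / 2)
  rw [S.form_comm _ y, huy, form_refl_refl, h2.form_yy, ← h2.form_ii, S.form_comm y, hul, hli0,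
    hly0, h2.form_ii] at cs
  have hp2 : (S.form (S.simple l) (S.simple k)) ^ 2 * 8 ≤
      3 * (S.form (S.simple k) (S.simple k) * S.form (S.simple l) (S.simple l)) := by
    rcases h2.eq_or with rfl | rfl <;> linarith
  obtain ⟨e1, e2⟩ := form_eq_of_neg_of_sq_le (S.simple_mem l) (S.simple_mem k) hkl hp2
  exact ⟨e1, hli0, e2, hly0⟩

end IsMinimalObtuse

/-! ### The fourth and fifth letters -/

lemma form_refl_nonpos {j : I} {x v : V} (h1 : S.form x (S.simple j) ≤ 0)
    (h2 : S.form (S.simple j) v ≤ 0) (h3 : S.form x v ≤ 0) : S.form (S.refl j x) v ≤ 0 := by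
  have : S.pairing x j ≤ 0 := div_nonpos_of_nonpos_of_nonneg (by linarith) (S.form_simple_pos j).le
  rw [refl_apply, map_sub, map_smul, LinearMap.sub_apply, LinearMap.smul_apply, smul_eq_mul]
  nlinarith

/-- The vector that turns out to be the negative of the fourth simple root modulo the radical of the
form. -/
noncomputable def negFourthRoot (S : ReflectionSystem I V) (y : V) (i k l : I) (p : ℝ) : V :=
  (2 : ℝ) • S.simple l + (3 : ℝ) • S.simple k + (2 / p) • (S.simple i - y)

lemma form_negFourthRoot (v y : V) (i k l : I) (p : ℝ) : S.form v (S.negFourthRoot y i k l p) =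
    2 * S.form v (S.simple l) + 3 * S.form v (S.simple k) +
      2 / p * (S.form v (S.simple i) - S.form v y) := by
  simp [negFourthRoot]

/-- The inner products forced by a right descent `m` of `w s_i s_k s_l`, the fourth letter from the
right of a reduced word of `w`. -/
structure IsFourthLetter (S : ReflectionSystem I V) (y : V) (i k l m : I) : Prop where
  form_mm : S.form (S.simple m) (S.simple m) = S.form (S.simple k) (S.simple k)
  form_mi : S.form (S.simple m) (S.simple i) = 0
  form_mk : S.form (S.simple m) (S.simple k) = 0
  form_ml : S.form (S.simple m) (S.simple l) = - S.form (S.simple k) (S.simple k) / 2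
  form_my : S.form (S.simple m) y = 0

variable {w : V ≃ₗ[ℝ] V} {i : I} {y : V} {k l m : I} {p : ℝ}

lemma form_negFourthRoot_self (h2 : S.IsSecondLetter w i y k p) (h3 : S.IsThirdLetter y i k l) :
    S.form (S.negFourthRoot y i k l p) (S.negFourthRoot y i k l p) =
      S.form (S.simple k) (S.simple k) := by
  have hp : p ≠ 0 := by rcases h2.eq_or with rfl | rfl <;> norm_num
  rw [form_negFourthRoot, S.form_comm _ (S.simple l), S.form_comm _ (S.simple k),
    S.form_comm _ (S.simple i), S.form_comm _ y]
  simp only [form_negFourthRoot, S.form_comm (S.simple k) (S.simple l),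
    S.form_comm (S.simple i) (S.simple l), S.form_comm y (S.simple l),
    S.form_comm (S.simple k) (S.simple i), S.form_comm (S.simple k) y,
    S.form_comm (S.simple i) y, h3.form_ll, h3.form_lk, h3.form_li, h3.form_ly, h2.form_ii,
    h2.form_ik, h2.form_yi, h2.form_yk, h2.form_yy]
  field_simp
  ring

lemma IsThirdLetter.refl_add (h3 : S.IsThirdLetter y i k l) :
    S.refl l (y + S.simple i) = y + S.simple i :=
  S.refl_of_form_eq_zero (by rw [form_comm, map_add, h3.form_li, h3.form_ly, add_zero])

lemma IsFourthLetter.form_add_self (h2 : S.IsSecondLetter w i y k p) (h3 : S.IsThirdLetter y i k l)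
    (h4 : S.IsFourthLetter y i k l m) : S.form (S.simple m + S.negFourthRoot y i k l p)
      (S.simple m + S.negFourthRoot y i k l p) = 0 := by
  simp only [map_add, LinearMap.add_apply, form_negFourthRoot_self h2 h3,
    S.form_comm _ (S.simple m), form_negFourthRoot, h4.form_mm, h4.form_mi, h4.form_mk, h4.form_ml,
    h4.form_my]
  ring

namespace IsMinimalObtuse

/-- The inversion `s_i s_k s_l (α m)` is not obtuse to `y`, which bounds the inner product of `α m`
with `negFourthRoot` so strongly that the Cauchy–Schwarz inequality must be an equality. -/
lemma isFourthLetter (h : S.IsMinimalObtuse w i y) (h2 : S.IsSecondLetter w i y k p)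
    (h3 : S.IsThirdLetter y i k l)
    (hl : S.ht (w (S.refl i (S.refl k (S.simple l)))) < 0)
    (hm : S.ht (w (S.refl i (S.refl k (S.refl l (S.simple m))))) < 0) :
    S.IsFourthLetter y i k l m := by
  have hN := S.form_simple_pos k
  have hM := S.form_simple_pos m
  have hp : 0 < p := by rcases h2.eq_or with rfl | rfl <;> norm_num
  have hki : S.form (S.simple k) (S.simple i) < 0 := by rw [form_comm, h2.form_ik]; nlinarith
  have hlk : S.form (S.simple l) (S.simple k) < 0 := by rw [h3.form_lk]; linarith
  have cs := S.form_sq_le (S.simple m) (S.negFourthRoot y i k l p)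
  rw [form_negFourthRoot_self h2 h3, form_negFourthRoot] at cs
  have hne : m ≠ l := ne_of_ht_refl_neg (w := w * S.refl i * S.refl k) hl hm
  -- If `m` commuted with `l`, it could take the place of `l`.
  have hml : S.form (S.simple m) (S.simple l) < 0 := by
    refine (S.form_simple_le hne).lt_of_ne fun h0 ↦ ?_
    rw [S.refl_of_form_eq_zero h0] at hm
    have h3' := h.isThirdLetter h2 hm
    rw [h0, h3'.form_lk, h3'.form_li, h3'.form_ly, h3'.form_ll] at cs
    nlinarith
  have hmi : m ≠ i := by
    rintro rfl
    rw [form_comm, h3.form_li] at hml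
    exact hml.false
  have hmk : m ≠ k := by
    rintro rfl
    refine (h.fc.mul_refl h.mem_range h.descent).false_of_three
      (mul_refl_mem_range h.mem_range i) hml ?_ h2.descent hl hm
    rw [pairing_eq_of (c := -1), pairing_eq_of (c := -1)]
    · norm_num
    · rw [h3.form_lk]; ring
    · rw [form_comm, h3.form_lk, h3.form_ll]; ring
  have ai := S.form_simple_le hmi
  have ak := S.form_simple_le hmk
  -- the inversion `s_i s_k s_l (α m)`
  have g1 := S.ht_refl_pos_of_form_nonpos (S.ht_simple_pos m) hml.le
  have f1 := form_refl_nonpos hml.le hlk.le ak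
  have g2 := S.ht_refl_pos_of_form_nonpos g1 f1
  have f2 := form_refl_nonpos f1 hki.le (form_refl_nonpos hml.le h3.form_li.le ai)
  have c := h.form_nonneg ⟨S.refl_mem i (S.refl_mem k (S.refl_mem l (S.simple_mem m))),
    S.ht_refl_pos_of_form_nonpos g2 f2, hm⟩ h.mem (S.refl_ne_simple g2) h.ne_simple
  rw [form_refl_left, form_refl_left, form_refl_left, h2.refl_eq_add, h2.refl_add,
    h3.refl_add, map_add] at c
  obtain ⟨b1, b2⟩ := form_le_of_neg (S.simple_mem m) (S.simple_mem l) hml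
  rw [h3.form_ll] at b2
  have hd : 2 / p * (S.form (S.simple m) (S.simple i) - S.form (S.simple m) y) ≤ 0 :=
    mul_nonpos_of_nonneg_of_nonpos (by positivity) (by linarith)
  have hd' : 2 / p * (S.form (S.simple m) (S.simple i) - S.form (S.simple m) y) = 0 →
      S.form (S.simple m) (S.simple i) = 0 ∧ S.form (S.simple m) y = 0 := fun h0 ↦ by
    have := (mul_eq_zero.1 h0).resolve_left (by positivity)
    constructor <;> linarith
  -- Equality holds in the Cauchy–Schwarz inequality.
  have e1 : S.form (S.simple m) (S.simple m) = S.form (S.simple k) (S.simple k) := by nlinarith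
  have e2 : S.form (S.simple m) (S.simple l) = - S.form (S.simple k) (S.simple k) / 2 := by
    nlinarith
  have e3 : S.form (S.simple m) (S.simple k) = 0 := by nlinarith
  obtain ⟨e4, e5⟩ := hd' (by nlinarith)
  exact ⟨e1, e4, e3, e2, e5⟩

/-- There is no smallest counterexample: `s_i y` is fixed by the reflections in the second, third
and fourth letters, so a fifth letter `n` exists, but `s_i s_k s_l s_m (α n)` is then obtuse to
`y`. -/
theorem false (h : S.IsMinimalObtuse w i y) : False := by
  have hw1 := mul_refl_mem_range h.mem_range i
  have hr := S.refl_mem i h.mem.1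
  have hpos := S.ht_refl_pos i h.mem.1 h.mem.2.1 h.ne_simple
  have hdesc {v : V ≃ₗ[ℝ] V} (hv : v ∈ Set.range S.wordProd) (he : v (S.refl i y) = w y) :
      ∃ j, S.ht (v (S.simple j)) < 0 := by
    obtain ⟨t, rfl⟩ := hv
    exact S.exists_descent hr hpos (by rw [he]; exact h.mem.2.2)
  -- The root `s_i y` stays an inversion, so there is always one more descent.
  obtain ⟨k, hk⟩ := hdesc hw1 (by simp [refl_refl])
  obtain ⟨p, h2⟩ := h.exists_isSecondLetter hk
  have hw2 := mul_refl_mem_range hw1 k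
  have r1 : S.refl k (S.refl i y) = S.refl i y := by rw [h2.refl_eq_add, h2.refl_add]
  obtain ⟨l, hl⟩ := hdesc hw2 (by simp [refl_refl, r1])
  have h3 := h.isThirdLetter h2 hl
  have hw3 := mul_refl_mem_range hw2 l
  have r2 : S.refl l (S.refl i y) = S.refl i y := by rw [h2.refl_eq_add, h3.refl_add]
  obtain ⟨m, hm⟩ := hdesc hw3 (by simp [refl_refl, r1, r2])
  have h4 := h.isFourthLetter h2 h3 hl hm
  have hw4 := mul_refl_mem_range hw3 m
  have r3 : S.refl m (S.refl i y) = S.refl i y := by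
    rw [h2.refl_eq_add]
    exact S.refl_of_form_eq_zero (by rw [form_comm, map_add, h4.form_mi, h4.form_my, add_zero])
  obtain ⟨n, hn⟩ := hdesc hw4 (by simp [refl_refl, r1, r2, r3])
  have hN := S.form_simple_pos k
  have hp : 0 < p := by rcases h2.eq_or with rfl | rfl <;> norm_num
  -- Modulo the radical, `α m` is the negative of `negFourthRoot`.
  have hE : S.form (S.simple n) (S.simple m) =
      -S.form (S.simple n) (S.negFourthRoot y i k l p) := by
    have := S.form_eq_zero_of_self (h4.form_add_self h2 h3) (S.simple n)
    rw [form_comm, map_add] at this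
    linarith
  have hki : S.form (S.simple k) (S.simple i) < 0 := by rw [form_comm, h2.form_ik]; nlinarith
  have hlk : S.form (S.simple l) (S.simple k) < 0 := by rw [h3.form_lk]; linarith
  have hml : S.form (S.simple m) (S.simple l) < 0 := by rw [h4.form_ml]; linarith
  have hne : n ≠ m := ne_of_ht_refl_neg (w := w * S.refl i * S.refl k * S.refl l) hm hn
  have hnm : S.form (S.simple n) (S.simple m) < 0 := by
    refine (S.form_simple_le hne).lt_of_ne fun h0 ↦ ?_
    rw [LinearEquiv.mul_apply, S.refl_of_form_eq_zero h0] at hn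
    have h4' := h.isFourthLetter h2 h3 hl hn
    rw [h0, form_negFourthRoot, h4'.form_ml, h4'.form_mk, h4'.form_mi, h4'.form_my] at hE
    linarith
  have hni : n ≠ i := by
    rintro rfl
    rw [form_comm, h4.form_mi] at hnm
    exact hnm.false
  have hnk : n ≠ k := by
    rintro rfl
    rw [form_comm, h4.form_mk] at hnm
    exact hnm.false
  have hnl : n ≠ l := by
    rintro rfl
    refine ((h.fc.mul_refl h.mem_range h.descent).mul_refl hw1 h2.descent).false_of_three
      hw2 hnm ?_ hl hm hn
    rw [pairing_eq_of (c := -1), pairing_eq_of (c := -1)]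
    · norm_num
    · rw [h4.form_ml, h3.form_ll]; ring
    · rw [form_comm, h4.form_ml, h4.form_mm]; ring
  have ai := S.form_simple_le hni
  have ak := S.form_simple_le hnk
  have al := S.form_simple_le hnl
  -- the inversion `s_i s_k s_l s_m (α n)`
  have g1 := S.ht_refl_pos_of_form_nonpos (S.ht_simple_pos n) hnm.le
  have f1 := form_refl_nonpos hnm.le hml.le al
  have f1k := form_refl_nonpos hnm.le h4.form_mk.le ak
  have f1i := form_refl_nonpos hnm.le h4.form_mi.le ai
  have g2 := S.ht_refl_pos_of_form_nonpos g1 f1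
  have f2 := form_refl_nonpos f1 hlk.le f1k
  have f2i := form_refl_nonpos f1 h3.form_li.le f1i
  have g3 := S.ht_refl_pos_of_form_nonpos g2 f2
  have f3 := form_refl_nonpos f2 hki.le f2i
  have c := h.form_nonneg
    ⟨S.refl_mem i (S.refl_mem k (S.refl_mem l (S.refl_mem m (S.simple_mem n)))),
      S.ht_refl_pos_of_form_nonpos g3 f3, hn⟩ h.mem (S.refl_ne_simple g3) h.ne_simple
  rw [form_refl_left, form_refl_left, form_refl_left, form_refl_left, r1, r2, r3, h2.refl_eq_add,
    map_add] at c
  have hd : 2 / p * (S.form (S.simple n) (S.simple i) - S.form (S.simple n) y) ≤ 0 :=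
    mul_nonpos_of_nonneg_of_nonpos (by positivity) (by linarith)
  rw [form_negFourthRoot] at hE
  linarith

end IsMinimalObtuse

/-- Inversions of a fully commutative element are pairwise non-obtuse. By induction on the length,
an obtuse pair must involve every simple root that is an inversion; this is the situation of
`IsMinimalObtuse`. -/
theorem form_nonneg_of_isFullyCommutative {w : V ≃ₗ[ℝ] V} {l : List I} (hl : S.IsReduced w l)
    (hw : S.IsFullyCommutative w) :
    ∀ x ∈ S.inversions w, ∀ y ∈ S.inversions w, 0 ≤ S.form x y := by
  induction hn : l.length using Nat.strong_induction_on generalizing w l with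
  | _ n ih =>
  have hr : w ∈ Set.range S.wordProd := ⟨l, hl.1⟩
  -- Removing a right descent `k` leaves an element for which the claim is known.
  have key (k : I) (hk : S.ht (w (S.simple k)) < 0) (x) (hx : x ∈ S.inversions w) (z)
      (hz : z ∈ S.inversions w) (hxk : x ≠ S.simple k) (hzk : z ≠ S.simple k) :
      0 ≤ S.form x z := by
    obtain ⟨t, ht⟩ := exists_isReduced_append hr hk <|
      exists_isReduced_append_nil <| mul_refl_mem_range hr k
    simp only [List.nil_append] at ht
    have hlen := ht.2 l hl.1
    have hlen' := hl.2 _ ht.1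
    have ht' := ht.append_left
    have htw : S.wordProd t = w * S.refl k := by
      rw [← ht.1]; simp [refl_mul_cancel]
    rw [htw] at ht'
    have hmem {v : V} (hv : v ∈ S.inversions w) (hvk : v ≠ S.simple k) :
        S.refl k v ∈ S.inversions (w * S.refl k) :=
      ⟨S.refl_mem k hv.1, S.ht_refl_pos k hv.1 hv.2.1 hvk, by simpa [refl_refl] using hv.2.2⟩
    rw [← S.form_refl_refl k]
    refine ih t.length ?_ ht' (hw.mul_refl hr hk) rfl _ (hmem hx hxk) _ (hmem hz hzk)
    simp at hlen; omega
  intro x hx y hy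
  by_contra! hneg
  obtain ⟨i, hi⟩ : ∃ i, S.ht (w (S.simple i)) < 0 := by
    rw [← hl.1] at hx ⊢
    exact S.exists_descent hx.1 hx.2.1 hx.2.2
  by_cases hxi : x = S.simple i
  · subst hxi
    exact IsMinimalObtuse.false ⟨hr, hw, hi, hy, by rwa [form_comm], key⟩
  · by_cases hyi : y = S.simple i
    · subst hyi
      exact IsMinimalObtuse.false ⟨hr, hw, hi, hx, hneg, key⟩
    · exact absurd hneg (key i hi x hx y hy hxi hyi).not_gt

/-! ### Roots as images of simple roots -/

/-- Every positive root is the image of a simple root under a product of simple reflections. -/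
lemma exists_wordProd_simple_eq (hint : ∀ x ∈ S.roots, ∃ n : ℤ, S.ht x = n) {x : V}
    (hx : x ∈ S.roots) (hp : 0 < S.ht x) : ∃ l i, x = S.wordProd l (S.simple i) := by
  obtain ⟨n, hn⟩ := hint x hx
  induction hN : n.toNat using Nat.strong_induction_on generalizing x n with
  | _ N ih =>
  obtain ⟨i, hi⟩ : ∃ i, 0 < S.form x (S.simple i) := by
    by_contra! h
    have : ∀ z ∈ AddSubmonoid.closure (Set.range S.simple), S.form x z ≤ 0 := by
      intro z hz
      induction hz using AddSubmonoid.closure_induction with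
      | mem z hz => obtain ⟨i, rfl⟩ := hz; exact h i
      | zero => simp
      | add a b _ _ ha hb => simpa using add_nonpos ha hb
    exact absurd (S.form_self_pos hx) (this x (S.mem_closure hx hp)).not_gt
  by_cases hxi : x = S.simple i
  · exact ⟨[], i, by simpa⟩
  have hp' := S.ht_refl_pos i hx hp hxi
  obtain ⟨n', hn'⟩ := hint _ (S.refl_mem i hx)
  have hlt : n' < n := by
    have : S.ht (S.refl i x) < S.ht x := by
      have : 0 < S.pairing x i := div_pos (by linarith) (S.form_simple_pos i)
      rw [refl_apply, map_sub, map_smul, smul_eq_mul]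
      nlinarith [S.ht_simple_pos i]
    rw [hn, hn'] at this
    exact_mod_cast this
  have h0 : 0 < n' := by rw [hn'] at hp'; exact_mod_cast hp'
  obtain ⟨l, j, h⟩ := ih n'.toNat (by omega) (S.refl_mem i hx) hp' n' hn' rfl
  exact ⟨i :: l, j, by rw [wordProd_cons, LinearEquiv.mul_apply, ← h, refl_refl]⟩

end ReflectionSystem

/-! ### The highest root -/

section HighestRoot

variable {ι M N : Type*} [AddCommGroup M] [Module ℝ M] [AddCommGroup N] [Module ℝ N]
  {P : RootPairing ι ℝ M N} (b : P.Base)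

/-- The monoid of sums of simple roots. -/
abbrev posCone : AddSubmonoid M := AddSubmonoid.closure (P.root '' (b.support : Set ι))

variable {b}

lemma root_mem_posCone {i : ι} (hi : i ∈ b.support) : P.root i ∈ posCone b :=
  AddSubmonoid.subset_closure ⟨i, hi, rfl⟩

/-- A root that is maximal for the order whose positive cone is generated by the simple roots. -/
def IsMaximal (b : P.Base) (i : ι) : Prop :=
  ∀ j, P.root j - P.root i ∈ posCone b → j = i

lemma IsMaximal.mem_posCone {i : ι} (h : IsMaximal b i) : P.root i ∈ posCone b := by
  have : IsAddTorsionFree M := .of_isTorsionFree ℝ M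
  refine (b.root_mem_or_neg_mem i).resolve_right fun hn ↦ ?_
  have h1 : P.root (P.reflectionPerm i i) = -P.root i := by simp
  have h2 := congrArg P.root (h (P.reflectionPerm i i) (by
    rw [h1, sub_eq_add_neg]; exact add_mem hn hn))
  rw [h1] at h2
  exact P.ne_zero i (self_eq_neg.1 h2.symm)

section Height

variable [P.IsRootSystem]

/-- The linear form that takes the value one on each simple root. -/
noncomputable def heightMap (b : P.Base) : M →ₗ[ℝ] ℝ := b.toWeightBasis.constr ℝ fun _ ↦ 1

lemma heightMap_root_of_mem {i : ι} (hi : i ∈ b.support) : heightMap b (P.root i) = 1 := by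
  have := b.toWeightBasis.constr_basis ℝ (fun _ ↦ (1 : ℝ)) ⟨i, hi⟩
  rwa [RootPairing.Base.toWeightBasis_apply] at this

lemma heightMap_root (i : ι) : heightMap b (P.root i) = b.height i := by
  obtain ⟨f, -, -, hf⟩ := b.exists_root_eq_sum_int i
  rw [RootPairing.Base.height_eq_sum hf, hf, map_sum, Int.cast_sum]
  refine Finset.sum_congr rfl fun j hj ↦ ?_
  rw [map_zsmul, heightMap_root_of_mem hj, zsmul_one]

lemma heightMap_nonneg {x : M} (hx : x ∈ posCone b) : 0 ≤ heightMap b x := by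
  induction hx using AddSubmonoid.closure_induction with
  | mem x hx => obtain ⟨i, hi, rfl⟩ := hx; rw [heightMap_root_of_mem hi]; norm_num
  | zero => simp
  | add x y _ _ hx hy => rw [map_add]; exact add_nonneg hx hy

lemma eq_zero_of_heightMap_eq_zero {x : M} (hx : x ∈ posCone b) (h : heightMap b x = 0) :
    x = 0 := by
  induction hx using AddSubmonoid.closure_induction with
  | mem x hx =>
    obtain ⟨i, hi, rfl⟩ := hx
    rw [heightMap_root_of_mem hi] at h
    norm_num at h
  | zero => rfl
  | add x y hx hy ihx ihy =>
    rw [map_add] at h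
    have h1 := heightMap_nonneg hx
    have h2 := heightMap_nonneg hy
    rw [ihx (by linarith), ihy (by linarith), add_zero]

lemma eq_zero_of_mem_of_neg_mem {x : M} (hx : x ∈ posCone b) (h : -x ∈ posCone b) : x = 0 := by
  refine eq_zero_of_heightMap_eq_zero hx (le_antisymm ?_ (heightMap_nonneg hx))
  simpa using heightMap_nonneg h

lemma isPos_iff_mem_posCone {i : ι} : b.IsPos i ↔ P.root i ∈ posCone b := by
  have h0 := b.height_ne_zero i
  constructor
  · intro h
    refine (b.root_mem_or_neg_mem i).resolve_right fun hn ↦ ?_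
    have := heightMap_nonneg hn
    rw [map_neg, heightMap_root] at this
    rw [RootPairing.Base.isPos_iff] at h
    have h' : (0 : ℝ) < b.height i := by exact_mod_cast h
    linarith
  · intro h
    have := heightMap_nonneg h
    rw [heightMap_root] at this
    rw [RootPairing.Base.isPos_iff']
    exact_mod_cast this

lemma exists_isMaximal_ge [Finite ι] (j : ι) :
    ∃ i, P.root i - P.root j ∈ posCone b ∧ IsMaximal b i := by
  classical
  obtain ⟨i, hi, hmax⟩ := Set.exists_max_image {i | P.root i - P.root j ∈ posCone b}
    (fun i ↦ heightMap b (P.root i)) (Set.toFinite _) ⟨j, by simp⟩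
  refine ⟨i, hi, fun k hk ↦ P.root.injective ?_⟩
  have h1 : P.root k - P.root j ∈ posCone b := by
    have := add_mem hk hi
    rwa [sub_add_sub_cancel] at this
  have h2 := hmax k h1
  have h3 := heightMap_nonneg hk
  rw [map_sub] at h3
  exact sub_eq_zero.1 (eq_zero_of_heightMap_eq_zero hk (by rw [map_sub]; linarith))

lemma IsHighest.isMaximal {i : ι} (h : IsHighest b i) : IsMaximal b i := fun j hj ↦
  P.root.injective <| sub_eq_zero.1 <| eq_zero_of_mem_of_neg_mem hj (by simpa using h j)

lemma IsHighest.eq {i j : ι} (hi : IsHighest b i) (hj : IsHighest b j) : i = j :=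
  hj.isMaximal i (hi j)

end Height

variable [Fintype ι]

lemma rootForm_root_pos (i : ι) : 0 < P.RootForm (P.root i) (P.root i) :=
  P.rootForm_pos_of_ne_zero (Submodule.subset_span ⟨i, rfl⟩) (P.ne_zero i)

section Crystallographic

variable [P.IsCrystallographic]

lemma two_mul_rootForm (i j : ι) : 2 * P.RootForm (P.root i) (P.root j) =
    P.pairingIn ℤ i j * P.RootForm (P.root j) (P.root j) := by
  have := (P.posRootForm ℤ).two_mul_apply_root_root i j
  rw [← P.algebraMap_pairingIn ℤ] at this
  exact this

lemma rootForm_nonneg_iff {i j : ι} :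
    0 ≤ P.RootForm (P.root i) (P.root j) ↔ 0 ≤ P.pairingIn ℤ i j := by
  have h := two_mul_rootForm (P := P) i j
  have h0 := rootForm_root_pos (P := P) j
  constructor
  · intro h1
    have : (0 : ℝ) ≤ P.pairingIn ℤ i j := nonneg_of_mul_nonneg_left (by linarith) h0
    exact_mod_cast this
  · intro h1
    have : (0 : ℝ) ≤ P.pairingIn ℤ i j := by exact_mod_cast h1
    nlinarith

lemma rootForm_nonpos_iff {i j : ι} :
    P.RootForm (P.root i) (P.root j) ≤ 0 ↔ P.pairingIn ℤ i j ≤ 0 := by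
  have h := two_mul_rootForm (P := P) i j
  have h0 := rootForm_root_pos (P := P) j
  constructor
  · intro h1
    have : (P.pairingIn ℤ i j : ℝ) ≤ 0 := by
      by_contra! h2
      nlinarith
    exact_mod_cast this
  · intro h1
    have : (P.pairingIn ℤ i j : ℝ) ≤ 0 := by exact_mod_cast h1
    nlinarith

lemma IsMaximal.pairingIn_nonneg {i j : ι} (h : IsMaximal b i) (hj : j ∈ b.support) :
    0 ≤ P.pairingIn ℤ i j := by
  have : IsAddTorsionFree M := .of_isTorsionFree ℝ M
  by_contra! hneg
  by_cases hij : P.root i = -P.root j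
  · have h1 : i = j := (h j (by
      rw [hij, sub_neg_eq_add]; exact add_mem (root_mem_posCone hj) (root_mem_posCone hj))).symm
    subst h1
    exact P.ne_zero i (self_eq_neg.1 hij)
  · obtain ⟨k, hk⟩ := P.root_add_root_mem_of_pairingIn_neg hneg hij
    have h1 : k = i := h k (by rw [hk, add_sub_cancel_left]; exact root_mem_posCone hj)
    subst h1
    exact P.ne_zero j (by simpa using hk)

end Crystallographic

variable [P.IsRootSystem] [P.IsCrystallographic] [P.IsReduced] [P.IsIrreducible]

/-- All coefficients of a maximal root on the simple roots are positive: the simple roots with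
positive coefficient span an invariant subspace. -/
lemma IsMaximal.exists_pos_coeff {i : ι} (h : IsMaximal b i) :
    ∃ f : ι → ℝ, P.root i = ∑ j ∈ b.support, f j • P.root j ∧ ∀ j ∈ b.support, 0 < f j := by
  obtain ⟨f, -, hf⟩ := b.exists_root_eq_sum_nat_or_neg i
  replace hf : P.root i = ∑ j ∈ b.support, (f j : ℝ) • P.root j := by
    rcases hf with hf | hf
    · rw [hf]; simp only [Nat.cast_smul_eq_nsmul]
    · have : -P.root i ∈ posCone b := by
        rw [hf, neg_neg]
        exact sum_mem fun j hj ↦ nsmul_mem (root_mem_posCone hj) _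
      exact absurd (eq_zero_of_mem_of_neg_mem h.mem_posCone this) (P.ne_zero i)
  refine ⟨fun j ↦ f j, hf, fun j hj ↦ ?_⟩
  by_contra! hj0
  replace hj0 : f j = 0 := by
    have : (f j : ℝ) = 0 := le_antisymm hj0 (Nat.cast_nonneg _)
    exact_mod_cast this
  let J : Set ι := {k | k ∈ b.support ∧ f k ≠ 0}
  let q : Submodule ℝ M := Submodule.span ℝ (P.root '' J)
  -- The coefficient of `l ∉ J` in `θ` vanishes, so `0 ≤ (θ, α l)` is a sum of non-positive terms.
  have horth (k : ι) (hk : k ∈ J) (l : ι) (hl : l ∈ b.support) (hlJ : l ∉ J) :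
      P.pairing k l = 0 := by
    have hfl : f l = 0 := by by_contra h0; exact hlJ ⟨hl, h0⟩
    have h1 : 0 ≤ P.RootForm (P.root i) (P.root l) :=
      rootForm_nonneg_iff.2 (h.pairingIn_nonneg hl)
    rw [hf, map_sum, LinearMap.sum_apply] at h1
    simp only [map_smul, LinearMap.smul_apply, smul_eq_mul] at h1
    have h2 (m) (hm : m ∈ b.support) : (f m : ℝ) * P.RootForm (P.root m) (P.root l) ≤ 0 := by
      by_cases hml : m = l
      · simp [hml, hfl]
      · exact mul_nonpos_of_nonneg_of_nonpos (Nat.cast_nonneg _)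
          (rootForm_nonpos_iff.2 (b.pairingIn_le_zero_of_ne hml hm hl))
    have h3 := (Finset.sum_eq_zero_iff_of_nonpos h2).1
      (le_antisymm (Finset.sum_nonpos h2) h1) k hk.1
    have h4 := (mul_eq_zero.1 h3).resolve_left (by exact_mod_cast hk.2)
    have h5 := two_mul_rootForm (P := P) k l
    rw [h4, mul_zero, eq_comm] at h5
    have h6 := (mul_eq_zero.1 h5).resolve_right (rootForm_root_pos l).ne'
    rw [← P.algebraMap_pairingIn ℤ]
    simpa using h6
  have hinv : ∀ l ∈ b.support, q ∈ Module.End.invtSubmodule (P.reflection l) := by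
    intro l hl
    by_cases hlJ : l ∈ J
    · exact Submodule.mem_invtSubmodule_reflection_of_mem _ _ (Submodule.subset_span ⟨l, hlJ, rfl⟩)
    · rw [Module.End.mem_invtSubmodule, Submodule.span_le]
      rintro - ⟨k, hk, rfl⟩
      have : P.reflection l (P.root k) = P.root k := by
        rw [P.reflection_apply_root, horth k hk l hl hlJ, zero_smul, sub_zero]
      simpa [this] using Submodule.subset_span (Set.mem_image_of_mem P.root hk)
  have hq : q ≠ ⊥ := by
    intro hq
    refine P.ne_zero i ?_
    rw [hf]
    refine Finset.sum_eq_zero fun k hk ↦ ?_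
    by_cases hk0 : f k = 0
    · simp [hk0]
    · exact absurd ((Submodule.mem_bot ℝ).1 (hq ▸ Submodule.subset_span ⟨k, ⟨hk, hk0⟩, rfl⟩))
        (P.ne_zero k)
  have htop := RootPairing.IsIrreducible.eq_top_of_invtSubmodule_reflection (P := P) q
    ((b.forall_mem_support_invtSubmodule_iff q).1 hinv) hq
  have hker : q ≤ LinearMap.ker (b.toWeightBasis.coord ⟨j, hj⟩) := by
    rw [Submodule.span_le]
    rintro - ⟨k, hk, rfl⟩
    have hkj : k ≠ j := by rintro rfl; exact hk.2 hj0
    have := b.toWeightBasis_repr_root ⟨k, hk.1⟩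
    simp only at this
    simp [this, hkj]
  have := hker (htop ▸ Submodule.mem_top : P.root j ∈ q)
  have h' := b.toWeightBasis_repr_root ⟨j, hj⟩
  simp only at h'
  simp [h'] at this

/-- The inner product of two maximal roots is positive, so their difference is zero or a root. -/
lemma IsMaximal.eq {i j : ι} (hi : IsMaximal b i) (hj : IsMaximal b j) : i = j := by
  obtain ⟨f, hf, hpos⟩ := hi.exists_pos_coeff
  obtain ⟨g, hg, -⟩ := hj.exists_pos_coeff
  have hk (k) (hk : k ∈ b.support) : 0 ≤ P.RootForm (P.root k) (P.root j) := by
    rw [← P.rootForm_symmetric.eq, RingHom.id_apply]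
    exact rootForm_nonneg_iff.2 (hj.pairingIn_nonneg hk)
  have h0 : 0 < P.RootForm (P.root i) (P.root j) := by
    rw [hf, map_sum, LinearMap.sum_apply]
    simp only [map_smul, LinearMap.smul_apply, smul_eq_mul]
    have hnn (k) (hk' : k ∈ b.support) := mul_nonneg (hpos k hk').le (hk k hk')
    refine (Finset.sum_nonneg hnn).lt_of_ne' fun hz ↦ (rootForm_root_pos (P := P) j).ne' ?_
    have h1 := (Finset.sum_eq_zero_iff_of_nonneg hnn).1 hz
    nth_rewrite 1 [hg]
    rw [map_sum, LinearMap.sum_apply]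
    refine Finset.sum_eq_zero fun k hk' ↦ ?_
    rw [map_smul, LinearMap.smul_apply,
      (mul_eq_zero.1 (h1 k hk')).resolve_left (hpos k hk').ne', smul_zero]
  by_contra hij
  have h1 : 0 < P.pairingIn ℤ i j := by
    by_contra! h2
    exact h0.not_ge (rootForm_nonpos_iff.2 h2)
  obtain ⟨m, hm⟩ := P.root_sub_root_mem_of_pairingIn_pos h1 hij
  rcases b.root_mem_or_neg_mem m with h2 | h2
  · exact hij (hj i (hm ▸ h2))
  · exact hij (hi j (by rw [← neg_sub, ← hm]; exact h2)).symm

/-- An irreducible root system has a highest root. -/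
theorem exists_isHighest (b : P.Base) : ∃ i, IsHighest b i := by
  have : Nonempty ι := by
    by_contra! h
    have := RootPairing.IsIrreducible.nontrivial P
    obtain ⟨x, hx⟩ := exists_ne (0 : M)
    have h1 : x ∈ P.rootSpan ℝ := by simp
    simp [Set.range_eq_empty, RootPairing.rootSpan] at h1
    exact hx h1
  obtain ⟨i, -, hi⟩ := exists_isMaximal_ge (b := b) (Classical.arbitrary ι)
  refine ⟨i, fun j ↦ ?_⟩
  obtain ⟨k, hk, hk'⟩ := exists_isMaximal_ge (b := b) j
  rwa [hi.eq hk']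

end HighestRoot

/-! ### Affine root systems as reflection systems -/

section Affine

variable {ι M N : Type*} [AddCommGroup M] [Module ℝ M] [AddCommGroup N] [Module ℝ N]
  {P : RootPairing ι ℝ M N}

lemma reflection_fst (a : ι × ℤ) (x : M × ℝ) :
    (reflection P a x).1 = P.reflection a.1 x.1 := by
  simp [reflection, Module.reflection_apply, coroot, root, P.reflection_apply]

lemma root_injective : Function.Injective (root P) := by
  rintro ⟨i, m⟩ ⟨j, n⟩ h
  simp only [root, Prod.mk.injEq, Int.cast_inj] at h
  rw [P.root.injective h.1, h.2]

lemma root_reflectionPerm_self (i : ι) : P.root (P.reflectionPerm i i) = -P.root i := by simp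

lemma neg_mem_range_root {x : M × ℝ} (h : x ∈ Set.range (root P)) : -x ∈ Set.range (root P) := by
  obtain ⟨a, rfl⟩ := h
  exact ⟨(P.reflectionPerm a.1 a.1, -a.2), by ext <;> simp [root]⟩

variable {b : P.Base} {t : ι}

lemma IsHighest.root_add_mem (ht : IsHighest b t) (j : ι) :
    P.root t + P.root j ∈ posCone b := by
  have := ht (P.reflectionPerm j j)
  rwa [root_reflectionPerm_self, sub_neg_eq_add] at this

section Height

variable [P.IsRootSystem]

/-- The height on `M × ℝ` for which all affine simple roots have height one. -/
noncomputable def affineHeight (b : P.Base) (t : ι) : M × ℝ →ₗ[ℝ] ℝ :=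
  (heightMap b).comp (LinearMap.fst ℝ M ℝ) +
    (heightMap b (P.root t) + 1) • LinearMap.snd ℝ M ℝ

lemma affineHeight_root (a : ι × ℤ) : affineHeight b t (root P a) =
    heightMap b (P.root a.1) + (heightMap b (P.root t) + 1) * a.2 := rfl

lemma affineHeight_root_eq_intCast (a : ι × ℤ) :
    ∃ n : ℤ, affineHeight b t (root P a) = n :=
  ⟨b.height a.1 + (b.height t + 1) * a.2, by
    rw [affineHeight_root, heightMap_root, heightMap_root]; push_cast; rfl⟩

lemma IsHighest.heightMap_le (ht : IsHighest b t) (j : ι) :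
    heightMap b (P.root j) ≤ heightMap b (P.root t) := by
  have := heightMap_nonneg (ht j)
  rw [map_sub] at this
  linarith

lemma IsHighest.neg_heightMap_le (ht : IsHighest b t) (j : ι) :
    -heightMap b (P.root j) ≤ heightMap b (P.root t) := by
  have := heightMap_nonneg (ht.root_add_mem j)
  rw [map_add] at this
  linarith

lemma heightMap_pos_iff {i : ι} : 0 < heightMap b (P.root i) ↔ b.IsPos i := by
  rw [heightMap_root, Int.cast_pos]; rfl

lemma affineHeight_pos_iff (ht : IsHighest b t) (a : ι × ℤ) :
    0 < affineHeight b t (root P a) ↔ 0 < a.2 ∨ (a.2 = 0 ∧ b.IsPos a.1) := by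
  have h1 := ht.heightMap_le a.1
  have h2 := ht.neg_heightMap_le a.1
  rw [affineHeight_root]
  rcases lt_trichotomy a.2 0 with h | h | h
  · have h3 : (a.2 : ℝ) ≤ -1 := by exact_mod_cast Int.le_sub_one_of_lt h
    constructor
    · intro h4; nlinarith
    · rintro (h4 | h4) <;> omega
  · simp [h, heightMap_pos_iff]
  · have h3 : (1 : ℝ) ≤ a.2 := by exact_mod_cast h
    exact iff_of_true (by nlinarith) (Or.inl h)

lemma affineHeight_ne_zero (ht : IsHighest b t) (a : ι × ℤ) :
    affineHeight b t (root P a) ≠ 0 := by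
  have h1 := ht.heightMap_le a.1
  have h2 := ht.neg_heightMap_le a.1
  rw [affineHeight_root]
  rcases lt_trichotomy a.2 0 with h | h | h
  · have h3 : (a.2 : ℝ) ≤ -1 := by exact_mod_cast Int.le_sub_one_of_lt h
    nlinarith
  · simpa [h, heightMap_root] using b.height_ne_zero a.1
  · have h3 : (1 : ℝ) ≤ a.2 := by exact_mod_cast h
    nlinarith

lemma IsSimple.eq_or (ht : IsHighest b t) {a : ι × ℤ} (ha : IsSimple b a) :
    (a.1 ∈ b.support ∧ a.2 = 0) ∨ (P.root a.1 = -P.root t ∧ a.2 = 1) := by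
  obtain h | ⟨i, hi, h1, h2⟩ := ha
  · exact Or.inl h
  · rw [hi.eq ht] at h1; exact Or.inr ⟨h1, h2⟩

lemma affineHeight_of_isSimple (ht : IsHighest b t) {a : ι × ℤ} (ha : IsSimple b a) :
    affineHeight b t (root P a) = 1 := by
  rw [affineHeight_root]
  rcases ha.eq_or ht with ⟨h1, h2⟩ | ⟨h1, h2⟩
  · rw [heightMap_root_of_mem h1, h2]; simp
  · rw [h1, h2, map_neg]; simp

lemma mem_posRoots_iff (ht : IsHighest b t) {x : M × ℝ} :
    x ∈ posRoots b ↔ x ∈ Set.range (root P) ∧ 0 < affineHeight b t x := by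
  constructor
  · rintro ⟨a, rfl, h⟩; exact ⟨⟨a, rfl⟩, (affineHeight_pos_iff ht a).2 h⟩
  · rintro ⟨⟨a, rfl⟩, h⟩; exact ⟨a, rfl, (affineHeight_pos_iff ht a).1 h⟩

lemma mem_negRoots_iff (ht : IsHighest b t) {x : M × ℝ} :
    x ∈ negRoots b ↔ x ∈ Set.range (root P) ∧ affineHeight b t x < 0 := by
  rw [negRoots, Set.mem_ofPred_eq, mem_posRoots_iff ht, map_neg, Left.neg_pos_iff]
  exact and_congr_left fun _ ↦ ⟨fun h ↦ neg_neg x ▸ neg_mem_range_root h, neg_mem_range_root⟩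

/-- Every positive affine root is a sum of affine simple roots. -/
lemma root_mem_closure (ht : IsHighest b t) {c : ι × ℤ} (hc : 0 < affineHeight b t (root P c)) :
    root P c ∈ AddSubmonoid.closure
      (Set.range fun a : {a : ι × ℤ // IsSimple b a} ↦ root P a.1) := by
  obtain ⟨i, n⟩ := c
  rw [affineHeight_pos_iff ht] at hc
  simp only at hc
  set C := AddSubmonoid.closure (Set.range fun a : {a : ι × ℤ // IsSimple b a} ↦ root P a.1)
  have hfin {x : M} (hx : x ∈ posCone b) : ((x, 0) : M × ℝ) ∈ C := by
    induction hx using AddSubmonoid.closure_induction with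
    | mem x hx =>
      obtain ⟨j, hj, rfl⟩ := hx
      exact AddSubmonoid.subset_closure ⟨⟨(j, 0), Or.inl ⟨hj, rfl⟩⟩, by simp [root]⟩
    | zero => exact zero_mem C
    | add x y _ _ hx hy => simpa using add_mem hx hy
  rcases hc with hn | ⟨rfl, hi⟩
  · obtain ⟨k, hk⟩ := Int.eq_ofNat_of_zero_le (show 0 ≤ n - 1 by omega)
    obtain rfl : n = k + 1 := by omega
    -- `β + (k + 1) δ = (k + 1) (δ - θ) + k θ + (θ + β)`
    have h0 : root P (P.reflectionPerm t t, 1) ∈ C := AddSubmonoid.subset_closure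
      ⟨⟨(P.reflectionPerm t t, 1), Or.inr ⟨t, ht, root_reflectionPerm_self t, rfl⟩⟩, rfl⟩
    have h1 := add_mem (nsmul_mem h0 (k + 1))
      (hfin (add_mem (nsmul_mem ht.isMaximal.mem_posCone k) (ht.root_add_mem i)))
    convert h1 using 1
    ext
    · simp only [root, root_reflectionPerm_self, Prod.fst_add, Prod.smul_fst, succ_nsmul, smul_neg]
      abel
    · simp [root]
  · simpa [root] using hfin (isPos_iff_mem_posCone.1 hi)

end Height

variable [Fintype ι]

lemma form_apply (x y : M × ℝ) : form P x y = P.RootForm x.1 y.1 := rfl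

lemma form_comm (x y : M × ℝ) : form P x y = form P y x := by
  rw [form_apply, form_apply, ← P.rootForm_symmetric.eq, RingHom.id_apply]

lemma form_root_pos (a : ι × ℤ) : 0 < form P (root P a) (root P a) := rootForm_root_pos a.1

lemma form_reflection (a : ι × ℤ) (x y : M × ℝ) :
    form P (reflection P a x) (reflection P a y) = form P x y := by
  simp only [form_apply, reflection_fst, P.rootForm_reflection_reflection_apply]

/-- The affine reflections are orthogonal reflections on the whole space. -/
lemma reflection_eq_sub_smul_root (a : ι × ℤ) (x : M × ℝ) :
    reflection P a x =
      x - (2 * form P x (root P a) / form P (root P a) (root P a)) • root P a := by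
  have h0 := form_root_pos (P := P) a
  have h1 := form_reflection (P := P) a x (root P a)
  have h2 : reflection P a (root P a) = -root P a := Module.reflection_apply_self _
  rw [h2] at h1
  simp only [reflection, Module.reflection_apply, map_sub, map_smul, map_neg, LinearMap.sub_apply,
    LinearMap.smul_apply, smul_eq_mul] at h1 ⊢
  have h3 : coroot P a x = 2 * form P x (root P a) / form P (root P a) (root P a) := by
    rw [eq_div_iff h0.ne']; linarith
  rw [h3]

lemma pairing_nonneg_iff {x y : M × ℝ} (hy : y ∈ Set.range (root P)) :
    0 ≤ pairing P x y ↔ 0 ≤ form P x y := by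
  obtain ⟨c, rfl⟩ := hy
  have h := form_root_pos (P := P) c
  rw [pairing, le_div_iff₀ h, zero_mul]
  exact mul_nonneg_iff_of_pos_left two_pos

lemma form_self_nonneg (x : M × ℝ) : 0 ≤ form P x x := by
  rw [form_apply, P.rootForm_apply_apply]
  exact Finset.sum_nonneg fun i _ ↦ mul_self_nonneg _

lemma fst_eq_of_form_sub_eq_zero [P.IsRootSystem] {x y : M × ℝ} (h : form P (x - y) (x - y) = 0) :
    x.1 = y.1 :=
  sub_eq_zero.1 (P.eq_zero_of_mem_rootSpan_of_rootForm_self_eq_zero (by simp) h)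

lemma reflection_root_eq [P.IsCrystallographic] (a c : ι × ℤ) :
    reflection P a (root P c) =
      root P (P.reflectionPerm a.1 c.1, c.2 - P.pairingIn ℤ c.1 a.1 * a.2) := by
  have h : (P.pairingIn ℤ c.1 a.1 : ℝ) = P.pairing c.1 a.1 := P.algebraMap_pairingIn ℤ c.1 a.1
  rw [reflection_root, pairing_root_root]
  ext
  · simp [root, P.reflection_apply_root]
  · simp [root, h]

lemma pairing_pairing_mem [P.IsCrystallographic] [P.IsReduced] [P.IsIrreducible]
    (hG2 : ¬ P.IsG2) (a c : ι × ℤ) :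
    (pairing P (root P a) (root P c), pairing P (root P c) (root P a)) ∈
      ({(0, 0), (1, 1), (1, 2), (2, 1), (2, 2),
        (-1, -1), (-1, -2), (-2, -1), (-2, -2)} : Set (ℝ × ℝ)) := by
  have hN := P.not_isG2_iff_isNotG2.1 hG2
  rw [RootPairing.isNotG2_iff] at hN
  have h1 := hN a.1 c.1
  have h2 := hN c.1 a.1
  have h3 := P.pairingIn_pairingIn_mem_set_of_isCrystal_of_isRed a.1 c.1
  rw [pairing_root_root, pairing_root_root, ← P.algebraMap_pairingIn ℤ, ← P.algebraMap_pairingIn ℤ]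
  generalize P.pairingIn ℤ a.1 c.1 = p at *
  generalize P.pairingIn ℤ c.1 a.1 = q at *
  simp only [Set.mem_insert_iff, Set.mem_singleton_iff, Prod.mk.injEq] at h1 h2 h3
  rcases h3 with h | h | h | h | h | h | h | h | h | h | h | h | h <;> obtain ⟨rfl, rfl⟩ := h <;>
    first | omega | norm_num

variable [P.IsRootSystem]

lemma affineHeight_le_of_form_sub_eq_zero (ht : IsHighest b t) {a c : ι × ℤ} (ha : IsSimple b a)
    (hc : 0 < affineHeight b t (root P c))
    (h : form P (root P c - root P a) (root P c - root P a) = 0) :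
    affineHeight b t (root P a) ≤ affineHeight b t (root P c) := by
  obtain ⟨i, n⟩ := c
  obtain ⟨j, m⟩ := a
  obtain rfl : i = j := P.root.injective (fst_eq_of_form_sub_eq_zero h)
  rw [affineHeight_pos_iff ht] at hc
  simp only at hc
  have hH := heightMap_nonneg ht.isMaximal.mem_posCone
  have hmn : m ≤ n := by
    rcases ha.eq_or ht with ⟨h1, h2⟩ | ⟨h1, h2⟩ <;> simp only at h1 h2
    · omega
    · have hi : ¬ b.IsPos i := by
        rw [isPos_iff_mem_posCone, h1]
        exact fun h ↦ P.ne_zero t (eq_zero_of_mem_of_neg_mem ht.isMaximal.mem_posCone h)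
      have := hc.resolve_right fun h ↦ hi h.2
      omega
  have hmn' : (m : ℝ) ≤ n := by exact_mod_cast hmn
  rw [affineHeight_root, affineHeight_root]
  simp only
  nlinarith

variable [P.IsCrystallographic]

lemma form_root_nonpos_of_isSimple (ht : IsHighest b t) {a c : ι × ℤ} (ha : IsSimple b a)
    (hc : IsSimple b c) (h : a ≠ c) : form P (root P a) (root P c) ≤ 0 := by
  have key {i j : ι} (hi : P.root i = -P.root t) (hj : j ∈ b.support) :
      P.RootForm (P.root i) (P.root j) ≤ 0 := by
    rw [hi, map_neg, LinearMap.neg_apply, neg_nonpos]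
    exact rootForm_nonneg_iff.2 (ht.isMaximal.pairingIn_nonneg hj)
  obtain ⟨i, m⟩ := a
  obtain ⟨j, n⟩ := c
  rcases ha.eq_or ht with ⟨h1, h2⟩ | ⟨h1, h2⟩ <;> rcases hc.eq_or ht with ⟨h3, h4⟩ | ⟨h3, h4⟩ <;>
    simp only at h1 h2 h3 h4 <;> subst h2 h4
  · exact rootForm_nonpos_iff.2 (b.pairingIn_le_zero_of_ne (fun h' ↦ h (Prod.ext h' rfl)) h1 h3)
  · rw [form_comm]; exact key h3 h1
  · exact key h1 h3
  · exact absurd (by rw [P.root.injective (h1.trans h3.symm)]) h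

variable [P.IsReduced]

/-- A simple affine reflection permutes the positive affine roots other than its own. -/
lemma affineHeight_reflection_pos (ht : IsHighest b t) {a c : ι × ℤ} (ha : IsSimple b a)
    (hc : 0 < affineHeight b t (root P c)) (hne : root P c ≠ root P a) :
    0 < affineHeight b t (reflection P a (root P c)) := by
  obtain ⟨i, n⟩ := c
  obtain ⟨j, m⟩ := a
  rw [reflection_root_eq]
  rw [affineHeight_pos_iff ht] at hc ⊢
  simp only at hc ⊢
  rcases ha.eq_or ht with ⟨h1, h2⟩ | ⟨h1, h2⟩
  · simp only at h1 h2
    subst h2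
    rw [mul_zero, sub_zero]
    refine hc.imp_right fun h ↦ ⟨h.1, h.2.reflectionPerm h1 ?_⟩
    rintro rfl
    exact hne (by rw [h.1])
  · simp only at h1 h2
    subst h2
    rw [mul_one]
    have hroot : P.root (P.reflectionPerm j i) =
        P.root i + (P.pairingIn ℤ i j : ℝ) • P.root t := by
      have h : (P.pairingIn ℤ i j : ℝ) = P.pairing i j := P.algebraMap_pairingIn ℤ i j
      rw [P.root_reflectionPerm, P.reflection_apply_root, h1, h]
      module
    have htpos := ht.isMaximal.mem_posCone
    -- The level `n` decreases by the Cartan integer `⟨β, -θ⟩`, which is at most `2`, with equality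
    -- only for `β = -θ`.
    rcases lt_trichotomy (P.pairingIn ℤ i j) 0 with hq | hq | hq
    · left; omega
    · rw [hq, Int.cast_zero, zero_smul, add_zero] at hroot
      rw [hq, sub_zero, P.root.injective hroot]
      exact hc
    · by_cases hq1 : P.pairingIn ℤ i j = 1
      · rw [hq1, Int.cast_one, one_smul, add_comm] at hroot
        rw [hq1]
        rcases lt_trichotomy n 1 with hn | hn | hn
        · -- `β` is positive, so `β + θ` exceeds the highest root.
          have hi : b.IsPos i := by rcases hc with h | h <;> [omega; exact h.2]
          have h3 := ht (P.reflectionPerm j i)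
          rw [hroot, sub_add_cancel_left] at h3
          exact absurd (eq_zero_of_mem_of_neg_mem (isPos_iff_mem_posCone.1 hi) h3) (P.ne_zero i)
        · right
          exact ⟨by omega, isPos_iff_mem_posCone.2 (hroot ▸ ht.root_add_mem i)⟩
        · left; omega
      · -- If `β + q θ` with `2 ≤ q` is a root, then both `-(β + θ)` and `β + θ` are sums of simple
        -- roots.
        have hij : i = j := by
          have h3 := ht (P.reflectionPerm j i)
          obtain ⟨k, hk⟩ := Int.eq_ofNat_of_zero_le (show 0 ≤ P.pairingIn ℤ i j - 2 by omega)
          have h4 := add_mem h3 (nsmul_mem htpos k)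
          have h5 : (P.pairingIn ℤ i j : ℝ) = k + 2 := by
            have : P.pairingIn ℤ i j = k + 2 := by omega
            rw [this]; push_cast; rfl
          have h6 : P.root t - P.root (P.reflectionPerm j i) + k • P.root t =
              -(P.root t + P.root i) := by
            rw [hroot, h5, ← Nat.cast_smul_eq_nsmul ℝ]; module
          rw [h6] at h4
          apply P.root.injective
          rw [h1]
          exact (neg_eq_of_add_eq_zero_right
            (eq_zero_of_mem_of_neg_mem (ht.root_add_mem i) h4)).symm
        subst hij
        have h2 : P.pairingIn ℤ i i = 2 := P.pairingIn_same ℤ i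
        rw [h2] at hroot ⊢
        have hi : ¬ b.IsPos i := by
          rw [isPos_iff_mem_posCone, h1]
          exact fun h ↦ P.ne_zero t (eq_zero_of_mem_of_neg_mem htpos h)
        have hn : n ≠ 1 := by rintro rfl; exact hne rfl
        have hn' : 0 < n := hc.resolve_right fun h ↦ hi h.2
        rcases lt_or_eq_of_le (show 2 ≤ n by omega) with h | h
        · left; omega
        · right
          refine ⟨by omega, isPos_iff_mem_posCone.2 ?_⟩
          rw [root_reflectionPerm_self, h1, neg_neg]
          exact htpos

variable [P.IsIrreducible]

/-- The affine root system, with the affine simple roots and their reflections. The exclusion of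
`G₂` enters through the bound on the Cartan integers. -/
noncomputable def affineSystem (ht : IsHighest b t) (hG2 : ¬ P.IsG2) :
    ReflectionSystem {a : ι × ℤ // IsSimple b a} (M × ℝ) where
  form := form P
  form_comm := form_comm
  form_self_nonneg := form_self_nonneg
  roots := Set.range (root P)
  simple a := root P a.1
  refl a := reflection P a.1
  ht := affineHeight b t
  form_self_pos := by rintro - ⟨c, rfl⟩; exact form_root_pos c
  ht_ne_zero := by rintro - ⟨c, rfl⟩; exact affineHeight_ne_zero ht c
  simple_injective := root_injective.comp Subtype.val_injective
  simple_mem a := ⟨a.1, rfl⟩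
  ht_simple_pos a := by rw [affineHeight_of_isSimple ht a.2]; exact one_pos
  refl_eq a x := reflection_eq_sub_smul_root a.1 x
  refl_mem a := by rintro - ⟨c, rfl⟩; exact ⟨_, (reflection_root_eq a.1 c).symm⟩
  ht_refl_pos a := by rintro - ⟨c, rfl⟩ hc hne; exact affineHeight_reflection_pos ht a.2 hc hne
  mem_closure := by rintro - ⟨c, rfl⟩ hc; exact root_mem_closure ht hc
  form_simple_le {a c} h := form_root_nonpos_of_isSimple ht a.2 c.2 (Subtype.val_injective.ne h)
  pairing_mem := by rintro - - ⟨a, rfl⟩ ⟨c, rfl⟩; exact pairing_pairing_mem hG2 a c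
  ht_simple_le a := by rintro - ⟨c, rfl⟩; exact affineHeight_le_of_form_sub_eq_zero ht a.2

/-- Reflections in a root and in its negative agree, and conjugating a simple reflection by an
element of the group generated by simple reflections gives the reflection in the image root. -/
lemma reflection_eq_conj (ht : IsHighest b t) (hG2 : ¬ P.IsG2) {c : ι × ℤ}
    {l : List {a : ι × ℤ // IsSimple b a}} {a : {a : ι × ℤ // IsSimple b a}}
    (h : root P c = wordProd b l (root P a.1) ∨ root P c = -wordProd b l (root P a.1)) :
    reflection P c * wordProd b l = wordProd b l * reflection P a.1 := by
  have hinv (x y : M × ℝ) : form P (wordProd b l x) (wordProd b l y) = form P x y :=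
    (affineSystem ht hG2).form_wordProd l x y
  ext1 x
  simp only [LinearEquiv.mul_apply]
  rw [reflection_eq_sub_smul_root, reflection_eq_sub_smul_root]
  rcases h with h | h <;> rw [h]
  · simp [hinv]
  · simp [hinv, neg_div]

/-- The affine Weyl group is generated by the simple reflections. -/
lemma exists_wordProd_eq_of_mem_weylGroup (ht : IsHighest b t) (hG2 : ¬ P.IsG2)
    {w : (M × ℝ) ≃ₗ[ℝ] (M × ℝ)} (hw : w ∈ weylGroup P) :
    ∃ l : List {a : ι × ℤ // IsSimple b a}, wordProd b l = w := by
  set S := affineSystem ht hG2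
  induction hw using Subgroup.closure_induction with
  | mem w hw =>
    obtain ⟨c, rfl⟩ := hw
    obtain ⟨l, a, h⟩ : ∃ (l : List {a : ι × ℤ // IsSimple b a}) (a : {a : ι × ℤ // IsSimple b a}),
        root P c = wordProd b l (root P a.1) ∨ root P c = -wordProd b l (root P a.1) := by
      have hint : ∀ x ∈ S.roots, ∃ n : ℤ, S.ht x = n := by
        rintro - ⟨c, rfl⟩; exact affineHeight_root_eq_intCast c
      rcases S.ht_pos_or_neg (x := root P c) ⟨c, rfl⟩ with h | h
      · obtain ⟨l, a, h'⟩ := S.exists_wordProd_simple_eq hint ⟨c, rfl⟩ h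
        exact ⟨l, a, Or.inl h'⟩
      · obtain ⟨l, a, h'⟩ := S.exists_wordProd_simple_eq hint
          (neg_mem_range_root ⟨c, rfl⟩ : -root P c ∈ S.roots) (by rw [map_neg]; linarith)
        exact ⟨l, a, Or.inr (neg_eq_iff_eq_neg.1 h')⟩
    refine ⟨l ++ a :: l.reverse, ?_⟩
    have h1 : S.wordProd (l ++ a :: l.reverse) = _ := S.wordProd_append l (a :: l.reverse)
    rw [S.wordProd_cons, S.wordProd_reverse, ← mul_assoc] at h1
    exact h1.trans (mul_inv_eq_iff_eq_mul.2 (reflection_eq_conj ht hG2 h).symm)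
  | one => exact ⟨[], rfl⟩
  | mul v w _ _ hv hw =>
    obtain ⟨l, rfl⟩ := hv
    obtain ⟨l', rfl⟩ := hw
    exact ⟨l ++ l', S.wordProd_append l l'⟩
  | inv w _ hw =>
    obtain ⟨l, rfl⟩ := hw
    exact ⟨l.reverse, S.wordProd_reverse l⟩

lemma inversionSet_eq (ht : IsHighest b t) (hG2 : ¬ P.IsG2) (l : List {a : ι × ℤ // IsSimple b a}) :
    inversionSet b (wordProd b l) = (affineSystem ht hG2).inversions (wordProd b l) := by
  ext x
  rw [inversionSet, Set.mem_ofPred_eq, mem_posRoots_iff ht, mem_negRoots_iff ht]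
  exact ⟨fun h ↦ ⟨h.1.1, h.1.2, h.2.2⟩,
    fun h ↦ ⟨⟨h.1, h.2.1⟩, (affineSystem ht hG2).wordProd_mem l h.1, h.2.2⟩⟩

end Affine
end AffineRoots

theorem mainTheorem5 {ι M N : Type*} [Fintype ι] [AddCommGroup M] [Module ℝ M]
    [AddCommGroup N] [Module ℝ N] (P : RootPairing ι ℝ M N) [P.IsRootSystem]
    [P.IsCrystallographic] [P.IsReduced] [P.IsIrreducible] (b : P.Base) (hG2 : ¬ P.IsG2)
    (w : (M × ℝ) ≃ₗ[ℝ] (M × ℝ)) (hw : w ∈ AffineRoots.weylGroup P) :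
    AffineRoots.IsFullyCommutative b w ↔
      ∀ x ∈ AffineRoots.inversionSet b w, ∀ y ∈ AffineRoots.inversionSet b w,
        0 ≤ AffineRoots.pairing P x y := by
  obtain ⟨t, ht⟩ := AffineRoots.exists_isHighest b
  let S := AffineRoots.affineSystem ht hG2
  obtain ⟨l₀, rfl⟩ := AffineRoots.exists_wordProd_eq_of_mem_weylGroup ht hG2 hw
  obtain ⟨l, hl⟩ := S.exists_isReduced l₀
  rw [AffineRoots.inversionSet_eq ht hG2]
  constructor
  · intro h x hx y hy
    rw [AffineRoots.pairing_nonneg_iff hy.1]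
    exact S.form_nonneg_of_isFullyCommutative hl h x hx y hy
  · intro h
    exact S.isFullyCommutative_of_form_nonneg fun x hx y hy ↦
      (AffineRoots.pairing_nonneg_iff hy.1).1 (h x hx y hy)
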